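/- For points $a=(a_x,a_y)$, $b=(b_x,b_y)$ of the plane let $d(a,b)=|a_x-b_x|+|a_y-b_y|$ be their $L_1$ distance. For a finite set $S\subset\mathbb{R}^2$ let $w(S)=\sum_{\{a,b\}\subseteq S}d(a,b)$ be its total pairwise distance, and for $c\in\mathbb{R}^2$ let $\ell(S,c)=\sum_{s\in S}d(c,s)$ be the length of the Steiner star of $S$ with centre $c$. A *minimum triple* of a finite set $P\subset\mathbb{R}^2$ is a set $S\subseteq P$ with $|S|=3$ such that $w(S)\le w(T)$ for all $T\subseteq P$ with $|T|=3$. **Theorem.** 1. There is an algorithm that, given any set $P$ of $n\ge 3$ points in the plane, finds a minimum triple of $P$ in $O(n\log n)$ time. Precisely: there are a single program for the real RAM (uniform cost; field operations and comparisons on reals; addition, truncated subtraction, comparison and array addressing on natural numbers; rational constants; no rounding) and a constant $C$ such that, for every $n\ge 3$ and every list $p_0,\dots,p_{n-1}$ of distinct points in the plane, the program halts on this input after at most $C\,n\log n$ steps and outputs indices $i,j,k$ such that $\{p_i,p_j,p_k\}$ is a minimum triple of $\{p_0,\dots,p_{n-1}\}$. 2. Let $S$ be a minimum triple of a finite set $P\subset\mathbb{R}^2$.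 Then there is exactly one point $c$ of the plane that minimizes $\ell(S,\cdot)$; its star is smallest among the Steiner stars of all triples of $P$, that is, $\ell(S,c)\le\ell(T,x)$ for all $T\subseteq P$ with $|T|=3$ and all $x\in\mathbb{R}^2$; and the points of $S$ are three nearest points of $P$ to $c$ (ties allowed), that is, $c$ lies in the order-3 $L_1$ Voronoi cell $\{x : d(x,s)\le d(x,q)\text{ for all } s\in S,\ q\in P\setminus S\}$ of $S$, so this cell is nonempty. -/

import Mathlib

open scoped Classical in
/-- The finite point set enumerated by a list of `n` points of the plane. -/
noncomputable def pointSet {n : ℕ} (p : Fin n → ℝ × ℝ) : Finset (ℝ × ℝ) :=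
  Finset.univ.image p

/-- The `L₁` (Manhattan) distance of two points of the plane. -/
noncomputable def l1Dist (a b : ℝ × ℝ) : ℝ := |a.1 - b.1| + |a.2 - b.2|

/-- `l1Dist` is the metric of Mathlib's `L¹` product `WithLp 1 (ℝ × ℝ)`. -/
theorem l1Dist_eq_dist (a b : ℝ × ℝ) :
    l1Dist a b = dist (WithLp.toLp 1 a) (WithLp.toLp 1 b) := by
  simp [l1Dist, WithLp.prod_dist_eq_of_L1, Real.dist_eq]

/-- Total pairwise `L₁` distance of a finite set: the sum over its unordered pairs of points.
The double sum runs over ordered pairs and so meets each unordered pair twice. -/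
noncomputable def totalPairwiseDist (S : Finset (ℝ × ℝ)) : ℝ :=
  (∑ a ∈ S, ∑ b ∈ S, l1Dist a b) / 2

/-- `S` is a 3-point subset of `P` whose total pairwise `L₁` distance is minimum among all
3-point subsets of `P`. -/
def IsMinTriple (P S : Finset (ℝ × ℝ)) : Prop :=
  S ⊆ P ∧ S.card = 3 ∧
    ∀ T : Finset (ℝ × ℝ), T ⊆ P → T.card = 3 → totalPairwiseDist S ≤ totalPairwiseDist T

/-- Length of the Steiner star that joins the centre `c`, an arbitrary point of the plane,
to all points of `S`. -/
noncomputable def starLength (S : Finset (ℝ × ℝ)) (c : ℝ × ℝ) : ℝ := ∑ s ∈ S, l1Dist c s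

/-- `c` is the centre of a smallest Steiner star of `S`. -/
def IsStarCentre (S : Finset (ℝ × ℝ)) (c : ℝ × ℝ) : Prop :=
  ∀ x : ℝ × ℝ, starLength S c ≤ starLength S x

/-- The (closed) cell of `S ⊆ P` in the `L₁` Voronoi diagram of `P` of order `S.card`: the points
of the plane for which the points of `S` are nearest among the points of `P`, ties allowed. -/
def voronoiCell (P S : Finset (ℝ × ℝ)) : Set (ℝ × ℝ) :=
  {x | ∀ s ∈ S, ∀ q ∈ P, q ∉ S → l1Dist x s ≤ l1Dist x q}

/-! ### A real RAM

A machine with variables and arrays of natural numbers (used for counting and addressing) and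
variables and arrays of real numbers. A program is a finite piece of syntax. Every
elementary operation (reading a variable or an array cell, a constant, an arithmetic operation,
a comparison, a Boolean connective, an assignment, a branch, a loop test) takes one step.
Reals admit the four field operations and comparison, naturals admit addition, truncated
subtraction and comparison; there is no conversion between naturals and reals, and no rounding. -/

namespace RealRAM

/-- A memory: `nvar i` and `rvar i` are the contents of the `i`-th natural and the `i`-th real
variable, `narr a k` and `rarr a k` the `k`-th cell of the `a`-th natural and real array. -/
@[ext] structure Memory where
  nvar : ℕ → ℕ
  rvar : ℕ → ℝ
  narr : ℕ → ℕ → ℕ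
  rarr : ℕ → ℕ → ℝ

/-- Expressions with natural values; `cell a e` reads array `a` at the index given by `e`. -/
inductive NExp where
  | const (m : ℕ)
  | var (i : ℕ)
  | cell (a : ℕ) (e : NExp)
  | plus (e f : NExp)
  | minus (e f : NExp)

/-- Expressions with real values. Constants are rational. -/
inductive RExp where
  | const (q : ℚ)
  | var (i : ℕ)
  | cell (a : ℕ) (e : NExp)
  | plus (e f : RExp)
  | minus (e f : RExp)
  | times (e f : RExp)
  | divide (e f : RExp)

/-- Tests. -/
inductive Test where
  | natLt (e f : NExp)
  | realLt (e f : RExp)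
  | neg (b : Test)
  | conj (b c : Test)
  | disj (b c : Test)

/-- Value of a natural expression in a memory. -/
def NExp.val (σ : Memory) : NExp → ℕ
  | .const m => m
  | .var i => σ.nvar i
  | .cell a e => σ.narr a (e.val σ)
  | .plus e f => e.val σ + f.val σ
  | .minus e f => e.val σ - f.val σ

/-- Number of elementary operations needed to evaluate a natural expression. -/
def NExp.cost : NExp → ℕ
  | .const _ => 1
  | .var _ => 1
  | .cell _ e => e.cost + 1
  | .plus e f => e.cost + f.cost + 1
  | .minus e f => e.cost + f.cost + 1

/-- Value of a real expression in a memory (a quotient with denominator `0` is `0`). -/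
noncomputable def RExp.val (σ : Memory) : RExp → ℝ
  | .const q => (q : ℝ)
  | .var i => σ.rvar i
  | .cell a e => σ.rarr a (e.val σ)
  | .plus e f => e.val σ + f.val σ
  | .minus e f => e.val σ - f.val σ
  | .times e f => e.val σ * f.val σ
  | .divide e f => e.val σ / f.val σ

/-- Number of elementary operations needed to evaluate a real expression. -/
def RExp.cost : RExp → ℕ
  | .const _ => 1
  | .var _ => 1
  | .cell _ e => e.cost + 1
  | .plus e f => e.cost + f.cost + 1
  | .minus e f => e.cost + f.cost + 1
  | .times e f => e.cost + f.cost + 1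
  | .divide e f => e.cost + f.cost + 1

/-- Truth of a test in a memory. -/
def Test.Holds (σ : Memory) : Test → Prop
  | .natLt e f => e.val σ < f.val σ
  | .realLt e f => e.val σ < f.val σ
  | .neg b => ¬ b.Holds σ
  | .conj b c => b.Holds σ ∧ c.Holds σ
  | .disj b c => b.Holds σ ∨ c.Holds σ

/-- Number of elementary operations needed to evaluate a test. -/
def Test.cost : Test → ℕ
  | .natLt e f => e.cost + f.cost + 1
  | .realLt e f => e.cost + f.cost + 1
  | .neg b => b.cost + 1
  | .conj b c => b.cost + c.cost + 1
  | .disj b c => b.cost + c.cost + 1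

/-- Programs. -/
inductive Program where
  | skip
  | setN (i : ℕ) (e : NExp)
  | setR (i : ℕ) (e : RExp)
  | storeN (a : ℕ) (k e : NExp)
  | storeR (a : ℕ) (k : NExp) (e : RExp)
  | seq (c d : Program)
  | ite (b : Test) (c d : Program)
  | loop (b : Test) (c : Program)

/-- Assign a natural variable. -/
def Memory.setN (σ : Memory) (i m : ℕ) : Memory :=
  { σ with nvar := Function.update σ.nvar i m }

/-- Assign a real variable. -/
noncomputable def Memory.setR (σ : Memory) (i : ℕ) (r : ℝ) : Memory :=
  { σ with rvar := Function.update σ.rvar i r }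

/-- Assign a cell of a natural array. -/
def Memory.storeN (σ : Memory) (a k m : ℕ) : Memory :=
  { σ with narr := Function.update σ.narr a (Function.update (σ.narr a) k m) }

/-- Assign a cell of a real array. -/
noncomputable def Memory.storeR (σ : Memory) (a k : ℕ) (r : ℝ) : Memory :=
  { σ with rarr := Function.update σ.rarr a (Function.update (σ.rarr a) k r) }

/-- `Runs c σ t τ`: started in memory `σ`, the program `c` halts after exactly `t` steps
in memory `τ`. -/
inductive Runs : Program → Memory → ℕ → Memory → Prop
  | skip (σ : Memory) : Runs .skip σ 1 σ
  | setN (σ : Memory) (i : ℕ) (e : NExp) :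
      Runs (.setN i e) σ (e.cost + 1) (σ.setN i (e.val σ))
  | setR (σ : Memory) (i : ℕ) (e : RExp) :
      Runs (.setR i e) σ (e.cost + 1) (σ.setR i (e.val σ))
  | storeN (σ : Memory) (a : ℕ) (k e : NExp) :
      Runs (.storeN a k e) σ (k.cost + e.cost + 1) (σ.storeN a (k.val σ) (e.val σ))
  | storeR (σ : Memory) (a : ℕ) (k : NExp) (e : RExp) :
      Runs (.storeR a k e) σ (k.cost + e.cost + 1) (σ.storeR a (k.val σ) (e.val σ))
  | seq {c d : Program} {σ ρ τ : Memory} {s t : ℕ} :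
      Runs c σ s ρ → Runs d ρ t τ → Runs (.seq c d) σ (s + t) τ
  | iteTrue {b : Test} {c d : Program} {σ τ : Memory} {t : ℕ} :
      b.Holds σ → Runs c σ t τ → Runs (.ite b c d) σ (b.cost + 1 + t) τ
  | iteFalse {b : Test} {c d : Program} {σ τ : Memory} {t : ℕ} :
      ¬ b.Holds σ → Runs d σ t τ → Runs (.ite b c d) σ (b.cost + 1 + t) τ
  | loopStop {b : Test} {c : Program} {σ : Memory} :
      ¬ b.Holds σ → Runs (.loop b c) σ (b.cost + 1) σ
  | loopStep {b : Test} {c : Program} {σ ρ τ : Memory} {s t : ℕ} :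
      b.Holds σ → Runs c σ s ρ → Runs (.loop b c) ρ t τ →
        Runs (.loop b c) σ (b.cost + 1 + s + t) τ

/-- The initial memory for the input points `p 0, …, p (n - 1)`: natural variable `0` holds `n`,
real arrays `0` and `1` hold the `x`- and `y`-coordinates, everything else is `0`. -/
noncomputable def inputMemory {n : ℕ} (p : Fin n → ℝ × ℝ) : Memory where
  nvar := fun i => if i = 0 then n else 0
  rvar := fun _ => 0
  narr := fun _ _ => 0
  rarr := fun a k =>
    if h : k < n then
      if a = 0 then (p ⟨k, h⟩).1 else if a = 1 then (p ⟨k, h⟩).2 else 0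
    else 0

end RealRAM

/-! The algorithm is divide and conquer, as for closest pairs. The points are sorted by `x`; a
bottom-up merge sort by `y` then joins neighbouring blocks of the `x`-order, and throughout `D` is
the weight of the best triple found so far. When two blocks on the two sides of a vertical line are
joined, only triples that meet both can be new. Twice any coordinate difference within a triple is
at most its weight, so a triple meeting both sides with a point at horizontal distance at least `D /
2` from the line weighs at least `D` (`Sides.le_triWeight_of_far`). Only the strip around the line
remains.

The strip is scanned by increasing `y`, and each new point is tried only with pairs among the 16
preceding strip points. A lighter triple with an earlier point would put 17 points into two squares
of side `D / 2`, one on each side of the line. Each square holds at most 8: cut it into four cells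
of side `D / 4`; three points in one cell would weigh less than `D`, although both sides are free of
such triples (`TriplesGE.card_le_eight`, `StripState.triplesGE_insert`). So a join takes linear
time, and there are logarithmically many levels.

For the machine this becomes a Hoare logic with time bounds: `Halts`, a frame rule, and a loop rule
with a potential. Natural array 0 holds the `x`-order, 2 the `y`-order, 3 the strip, and 1 is
scratch space; real variable 0 is the best weight.

For the second half, the `L₁` star length splits into coordinates, and three reals have a sharp
median (`exists_median`). So the shortest star of a triple has length half its total distance and a
unique centre, and minimum triples are those with the shortest stars. Exchanging one point of the
triple for another point of `P` cannot shorten the star at the centre, which is the Voronoi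
property. -/

namespace RealRAM

/-! ### Frame conditions and timed Hoare rules -/

/-- Natural variables that a program may write. -/
def Program.nvars : Program → List ℕ
  | .skip => []
  | .setN i _ => [i]
  | .setR _ _ => []
  | .storeN _ _ _ => []
  | .storeR _ _ _ => []
  | .seq c d => c.nvars ++ d.nvars
  | .ite _ c d => c.nvars ++ d.nvars
  | .loop _ c => c.nvars

/-- Real variables that a program may write. -/
def Program.rvars : Program → List ℕ
  | .skip => []
  | .setN _ _ => []
  | .setR i _ => [i]
  | .storeN _ _ _ => []
  | .storeR _ _ _ => []
  | .seq c d => c.rvars ++ d.rvars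
  | .ite _ c d => c.rvars ++ d.rvars
  | .loop _ c => c.rvars

/-- Natural arrays that a program may write. -/
def Program.narrs : Program → List ℕ
  | .skip => []
  | .setN _ _ => []
  | .setR _ _ => []
  | .storeN a _ _ => [a]
  | .storeR _ _ _ => []
  | .seq c d => c.narrs ++ d.narrs
  | .ite _ c d => c.narrs ++ d.narrs
  | .loop _ c => c.narrs

/-- Real arrays that a program may write. -/
def Program.rarrs : Program → List ℕ
  | .skip => []
  | .setN _ _ => []
  | .setR _ _ => []
  | .storeN _ _ _ => []
  | .storeR a _ _ => [a]
  | .seq c d => c.rarrs ++ d.rarrs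
  | .ite _ c d => c.rarrs ++ d.rarrs
  | .loop _ c => c.rarrs

/-- The memories `σ` and `τ` agree on everything that `c` cannot write. -/
structure Program.Frame (c : Program) (σ τ : Memory) : Prop where
  nvar : ∀ i ∉ c.nvars, τ.nvar i = σ.nvar i
  rvar : ∀ i ∉ c.rvars, τ.rvar i = σ.rvar i
  narr : ∀ a ∉ c.narrs, τ.narr a = σ.narr a
  rarr : ∀ a ∉ c.rarrs, τ.rarr a = σ.rarr a

theorem Program.Frame.refl (c : Program) (σ : Memory) : c.Frame σ σ :=
  ⟨fun _ _ => rfl, fun _ _ => rfl, fun _ _ => rfl, fun _ _ => rfl⟩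

theorem Program.Frame.trans {c : Program} {σ ρ τ : Memory} (h : c.Frame σ ρ) (h' : c.Frame ρ τ) :
    c.Frame σ τ :=
  ⟨fun i hi => (h'.nvar i hi).trans (h.nvar i hi), fun i hi => (h'.rvar i hi).trans (h.rvar i hi),
    fun i hi => (h'.narr i hi).trans (h.narr i hi), fun i hi => (h'.rarr i hi).trans (h.rarr i hi)⟩

theorem Program.Frame.mono {c d : Program} {σ τ : Memory} (h : c.Frame σ τ)
    (h1 : c.nvars ⊆ d.nvars) (h2 : c.rvars ⊆ d.rvars) (h3 : c.narrs ⊆ d.narrs)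
    (h4 : c.rarrs ⊆ d.rarrs) : d.Frame σ τ :=
  ⟨fun i hi => h.nvar i fun h => hi (h1 h), fun i hi => h.rvar i fun h => hi (h2 h),
    fun i hi => h.narr i fun h => hi (h3 h), fun i hi => h.rarr i fun h => hi (h4 h)⟩

/-- Whatever is not a syntactic write target is preserved, so loop invariants need to mention only
what changes; side conditions on concrete programs become list membership checks. -/
theorem Runs.frame {c : Program} {σ τ : Memory} {t : ℕ} (h : Runs c σ t τ) : c.Frame σ τ := by
  induction h with
  | skip σ => exact .refl _ _
  | setN σ i e =>
    refine ⟨fun j hj => ?_, fun _ _ => rfl, fun _ _ => rfl, fun _ _ => rfl⟩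
    exact Function.update_of_ne (by simpa [Program.nvars] using hj) _ _
  | setR σ i e =>
    refine ⟨fun _ _ => rfl, fun j hj => ?_, fun _ _ => rfl, fun _ _ => rfl⟩
    exact Function.update_of_ne (by simpa [Program.rvars] using hj) _ _
  | storeN σ a k e =>
    refine ⟨fun _ _ => rfl, fun _ _ => rfl, fun j hj => ?_, fun _ _ => rfl⟩
    exact Function.update_of_ne (by simpa [Program.narrs] using hj) _ _
  | storeR σ a k e =>
    refine ⟨fun _ _ => rfl, fun _ _ => rfl, fun _ _ => rfl, fun j hj => ?_⟩
    exact Function.update_of_ne (by simpa [Program.rarrs] using hj) _ _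
  | seq _ _ h1 h2 =>
    refine (h1.mono ?_ ?_ ?_ ?_).trans (h2.mono ?_ ?_ ?_ ?_) <;> intro <;>
      simp +contextual [Program.nvars, Program.rvars, Program.narrs, Program.rarrs]
  | iteTrue _ _ h =>
    refine h.mono ?_ ?_ ?_ ?_ <;> intro <;>
      simp +contextual [Program.nvars, Program.rvars, Program.narrs, Program.rarrs]
  | iteFalse _ _ h =>
    refine h.mono ?_ ?_ ?_ ?_ <;> intro <;>
      simp +contextual [Program.nvars, Program.rvars, Program.narrs, Program.rarrs]
  | loopStop _ => exact .refl _ _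
  | loopStep _ _ _ h1 h2 =>
    exact Program.Frame.trans ⟨h1.nvar, h1.rvar, h1.narr, h1.rarr⟩ h2

/-- Started in `σ`, the program `c` halts within `B` steps in a memory that satisfies `Q`. -/
def Halts (c : Program) (σ : Memory) (B : ℕ) (Q : Memory → Prop) : Prop :=
  ∃ (t : ℕ) (τ : Memory), Runs c σ t τ ∧ t ≤ B ∧ Q τ

theorem Halts.mono {c : Program} {σ : Memory} {B B' : ℕ} {Q Q' : Memory → Prop}
    (h : Halts c σ B Q) (hB : B ≤ B') (hQ : ∀ τ, c.Frame σ τ → Q τ → Q' τ) : Halts c σ B' Q' := by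
  obtain ⟨t, τ, hr, ht, hq⟩ := h
  exact ⟨t, τ, hr, ht.trans hB, hQ τ hr.frame hq⟩

theorem Halts.seq {c d : Program} {σ : Memory} {B B₁ B₂ : ℕ} {Q R : Memory → Prop}
    (h : Halts c σ B₁ R) (hd : ∀ ρ, c.Frame σ ρ → R ρ → Halts d ρ B₂ Q) (hB : B₁ + B₂ ≤ B) :
    Halts (.seq c d) σ B Q := by
  obtain ⟨s, ρ, hr, hs, hρ⟩ := h
  obtain ⟨t, τ, hr', ht, hq⟩ := hd ρ hr.frame hρ
  exact ⟨s + t, τ, .seq hr hr', by omega, hq⟩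

/-- Loop rule with an invariant `I r`, where the number `r` bounds the remaining work in units
of `K` steps. -/
theorem Halts.loop {b : Test} {c : Program} {K : ℕ} (I : ℕ → Memory → Prop) {σ₀ : Memory} {r₀ : ℕ}
    (h₀ : I r₀ σ₀)
    (h : ∀ r σ, I r σ → c.Frame σ₀ σ → b.Holds σ →
      ∃ r' B, B + (b.cost + 1) + K * r' ≤ K * r ∧ Halts c σ B (I r')) :
    Halts (.loop b c) σ₀ (K * r₀ + (b.cost + 1)) fun τ => (∃ r, I r τ) ∧ ¬ b.Holds τ := by
  suffices H : ∀ r σ, I r σ → c.Frame σ₀ σ →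
      Halts (.loop b c) σ (K * r + (b.cost + 1)) fun τ => (∃ r, I r τ) ∧ ¬ b.Holds τ from
    H r₀ σ₀ h₀ (.refl _ _)
  intro r
  induction r using Nat.strong_induction_on with
  | _ r ih =>
    intro σ hI hF
    by_cases hb : b.Holds σ
    · obtain ⟨r', B, hle, s, ρ, hr, hs, hρ⟩ := h r σ hI hF hb
      -- An iteration is charged at least `b.cost + 1 > 0` steps, so the potential drops strictly
      -- and the loop terminates.
      have hlt : r' < r := by
        by_contra hcon
        have := Nat.mul_le_mul_left K (not_lt.mp hcon)
        omega
      obtain ⟨t, τ, hr', ht, hq⟩ := ih r' hlt ρ hρ (hF.trans hr.frame)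
      exact ⟨_, τ, .loopStep hb hr hr', by omega, hq⟩
    · exact ⟨_, σ, .loopStop hb, by omega, ⟨r, hI⟩, hb⟩

/-- Whether a program has no loops. -/
def Program.loopFree : Program → Bool
  | .seq c d => c.loopFree && d.loopFree
  | .ite _ c d => c.loopFree && d.loopFree
  | .loop _ _ => false
  | _ => true

/-- A bound for the number of steps of a program without loops. -/
def Program.time : Program → ℕ
  | .skip => 1
  | .setN _ e => e.cost + 1
  | .setR _ e => e.cost + 1
  | .storeN _ k e => k.cost + e.cost + 1
  | .storeR _ k e => k.cost + e.cost + 1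
  | .seq c d => c.time + d.time
  | .ite b c d => b.cost + 1 + (c.time + d.time)
  -- Junk value, as in `exec`: both functions are used only under `loopFree`.
  | .loop b _ => b.cost + 1

open scoped Classical in
/-- The final memory of a program without loops. -/
noncomputable def Program.exec : Program → Memory → Memory
  | .skip, σ => σ
  | .setN i e, σ => σ.setN i (e.val σ)
  | .setR i e, σ => σ.setR i (e.val σ)
  | .storeN a k e, σ => σ.storeN a (k.val σ) (e.val σ)
  | .storeR a k e, σ => σ.storeR a (k.val σ) (e.val σ)
  | .seq c d, σ => d.exec (c.exec σ)
  | .ite b c d, σ => if b.Holds σ then c.exec σ else d.exec σ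
  | .loop _ _, σ => σ

/-- Straight-line code is thereby verified by computation: `simp` evaluates `exec` and `time`. -/
theorem Program.exists_runs_exec (c : Program) (hc : c.loopFree = true) (σ : Memory) :
    ∃ t, Runs c σ t (c.exec σ) ∧ t ≤ c.time := by
  induction c generalizing σ with
  | skip => exact ⟨_, .skip σ, le_rfl⟩
  | setN i e => exact ⟨_, .setN σ i e, le_rfl⟩
  | setR i e => exact ⟨_, .setR σ i e, le_rfl⟩
  | storeN a k e => exact ⟨_, .storeN σ a k e, le_rfl⟩
  | storeR a k e => exact ⟨_, .storeR σ a k e, le_rfl⟩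
  | seq c d ihc ihd =>
    simp only [Program.loopFree, Bool.and_eq_true] at hc
    obtain ⟨s, hs, hs'⟩ := ihc hc.1 σ
    obtain ⟨t, ht, ht'⟩ := ihd hc.2 (c.exec σ)
    exact ⟨_, .seq hs ht, by simp only [Program.time]; omega⟩
  | ite b c d ihc ihd =>
    simp only [Program.loopFree, Bool.and_eq_true] at hc
    by_cases hb : b.Holds σ
    · obtain ⟨s, hs, hs'⟩ := ihc hc.1 σ
      refine ⟨b.cost + 1 + s, ?_, by simp only [Program.time]; omega⟩
      simpa only [Program.exec, hb, if_true] using Runs.iteTrue hb hs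
    · obtain ⟨s, hs, hs'⟩ := ihd hc.2 σ
      refine ⟨b.cost + 1 + s, ?_, by simp only [Program.time]; omega⟩
      simpa only [Program.exec, hb, if_false] using Runs.iteFalse hb hs
  | loop b c _ => simp [Program.loopFree] at hc

theorem Halts.exec {c : Program} {σ : Memory} {B : ℕ} {Q : Memory → Prop}
    (hc : c.loopFree = true) (hB : c.time ≤ B) (hQ : Q (c.exec σ)) : Halts c σ B Q := by
  obtain ⟨t, ht, ht'⟩ := c.exists_runs_exec hc σ
  exact ⟨t, _, ht, ht'.trans hB, hQ⟩

theorem Halts.ite {b : Test} {c d : Program} {σ : Memory} {B : ℕ} {Q : Memory → Prop}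
    (hc : b.Holds σ → Halts c σ B Q) (hd : ¬ b.Holds σ → Halts d σ B Q) :
    Halts (.ite b c d) σ (b.cost + 1 + B) Q := by
  by_cases hb : b.Holds σ
  · obtain ⟨t, τ, hr, ht, hq⟩ := hc hb
    exact ⟨_, τ, .iteTrue hb hr, by omega, hq⟩
  · obtain ⟨t, τ, hr, ht, hq⟩ := hd hb
    exact ⟨_, τ, .iteFalse hb hr, by omega, hq⟩

@[simp] theorem Memory.setN_nvar (σ : Memory) (i m j : ℕ) :
    (σ.setN i m).nvar j = if j = i then m else σ.nvar j := by
  simp [Memory.setN, Function.update_apply]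

@[simp] theorem Memory.setN_rvar (σ : Memory) (i m : ℕ) : (σ.setN i m).rvar = σ.rvar := rfl

@[simp] theorem Memory.setN_narr (σ : Memory) (i m : ℕ) : (σ.setN i m).narr = σ.narr := rfl

@[simp] theorem Memory.setN_rarr (σ : Memory) (i m : ℕ) : (σ.setN i m).rarr = σ.rarr := rfl

@[simp] theorem Memory.setR_rvar (σ : Memory) (i j : ℕ) (r : ℝ) :
    (σ.setR i r).rvar j = if j = i then r else σ.rvar j := by
  simp [Memory.setR, Function.update_apply]

@[simp] theorem Memory.setR_nvar (σ : Memory) (i : ℕ) (r : ℝ) : (σ.setR i r).nvar = σ.nvar := rfl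

@[simp] theorem Memory.setR_rarr (σ : Memory) (i : ℕ) (r : ℝ) : (σ.setR i r).rarr = σ.rarr := rfl

@[simp] theorem Memory.storeN_narr (σ : Memory) (a k m b : ℕ) :
    (σ.storeN a k m).narr b = if b = a then Function.update (σ.narr a) k m else σ.narr b := by
  simp [Memory.storeN, Function.update_apply]

@[simp] theorem Memory.storeN_nvar (σ : Memory) (a k m : ℕ) : (σ.storeN a k m).nvar = σ.nvar := rfl

@[simp] theorem Memory.storeN_rvar (σ : Memory) (a k m : ℕ) : (σ.storeN a k m).rvar = σ.rvar := rfl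

end RealRAM

/-! ### Bottom-up divide and conquer -/

namespace RealRAM

/-- One pass of `bottomUp`, over the blocks of a fixed width. -/
def bottomUpInner (body : Program) : Program :=
  .loop (.natLt (.var 4) (.var 0))
    -- With truncated subtraction `n - (n - m)` is `min m n`, which clips the block limits to `n`.
    (.seq (.setN 5 (.minus (.var 0) (.minus (.var 0) (.plus (.var 4) (.var 3)))))
      (.seq (.setN 6 (.minus (.var 0) (.minus (.var 0) (.plus (.plus (.var 4) (.var 3)) (.var 3)))))
        (.seq body (.setN 4 (.var 6)))))

/-- Bottom-up divide and conquer over the positions `0, …, n - 1`, where `n` is in natural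
variable `0`: `body` joins the neighbouring blocks `[lo, mid)` and `[mid, hi)`, whose limits
are in natural variables `4`, `5` and `6`. -/
def bottomUp (body : Program) : Program :=
  .seq (.setN 3 (.const 1))
    (.loop (.natLt (.var 3) (.var 0))
      (.seq (.setN 4 (.const 0))
        (.seq (bottomUpInner body) (.setN 3 (.plus (.var 3) (.var 3))))))

theorem add_le_of_dvd_of_lt {d a b : ℕ} (ha : d ∣ a) (hb : d ∣ b) (h : a < b) : a + d ≤ b := by
  obtain ⟨x, rfl⟩ := ha
  obtain ⟨y, rfl⟩ := hb
  have : x < y := lt_of_mul_lt_mul_left h (Nat.zero_le _)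
  calc d * x + d = d * (x + 1) := by ring
    _ ≤ d * y := Nat.mul_le_mul_left _ this

section BottomUp

variable {body : Program} {n K : ℕ} {I : Memory → Prop} {seg : Memory → ℕ → ℕ → Prop}

/-- Here `I` is a global invariant and `seg σ a b` says that the block `[a, b)` is finished. A join
costs time linear in the length of its block, so over one pass the costs add up to a multiple of
`n`. -/
theorem bottomUpInner_halts (hnv : ∀ i ∈ body.nvars, i ≠ 0 ∧ i ≠ 3 ∧ i ≠ 4 ∧ i ≠ 6)
    (hI : ∀ σ i m, 3 ≤ i → i ≤ 6 → I σ → I (σ.setN i m))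
    (hseg : ∀ σ i m a b, 3 ≤ i → i ≤ 6 → seg σ a b → seg (σ.setN i m) a b)
    (hempty : ∀ σ a, seg σ a a)
    (hbody : ∀ σ lo mid hi, I σ → σ.nvar 0 = n → σ.nvar 4 = lo → σ.nvar 5 = mid →
      σ.nvar 6 = hi → lo < mid → mid ≤ hi → hi ≤ n → seg σ lo mid → seg σ mid hi →
      Halts body σ (K * (hi - lo)) fun τ => I τ ∧ seg τ lo hi ∧
        ∀ a b, b ≤ lo ∨ hi ≤ a → seg σ a b → seg τ a b)
    {σ₀ : Memory} {w : ℕ} (hw : 0 < w) (h0 : σ₀.nvar 0 = n) (h3 : σ₀.nvar 3 = w)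
    (h4 : σ₀.nvar 4 = 0) (hI0 : I σ₀) (hs : ∀ a, w ∣ a → a < n → seg σ₀ a (min (a + w) n)) :
    Halts (bottomUpInner body) σ₀ ((K + 30) * n + 4) fun τ => I τ ∧ τ.nvar 0 = n ∧ τ.nvar 3 = w ∧
      ∀ a, (w + w) ∣ a → a < n → seg τ a (min (a + (w + w)) n) := by
  -- To the left of the current position blocks of width `2 * w` are finished, from it onwards
  -- blocks of width `w`. The position is a multiple of `2 * w`, except that it ends clipped at `n`.
  refine (Halts.loop (K := K + 30) (r₀ := n) (fun r σ => I σ ∧ σ.nvar 0 = n ∧ σ.nvar 3 = w ∧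
    r = n - σ.nvar 4 ∧ (σ.nvar 4 = n ∨ σ.nvar 4 < n ∧ (w + w) ∣ σ.nvar 4) ∧
    (∀ a, (w + w) ∣ a → a < σ.nvar 4 → seg σ a (min (a + (w + w)) n)) ∧
    ∀ a, w ∣ a → σ.nvar 4 ≤ a → a < n → seg σ a (min (a + w) n)) ?_ ?_).mono
    (by simp [Test.cost, NExp.cost]) ?_
  · refine ⟨hI0, h0, h3, by omega, ?_, by simp [h4], fun a ha _ => hs a ha⟩
    rcases Nat.eq_zero_or_pos n with rfl | hn
    · exact .inl h4
    · exact .inr ⟨by omega, by simp [h4]⟩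
  · rintro r σ ⟨hIσ, h0, h3, rfl, h4, hdone, htodo⟩ - hb
    simp only [Test.Holds, NExp.val, h0] at hb
    have hdvd : (w + w) ∣ σ.nvar 4 := by omega
    set lo := σ.nvar 4 with hlo
    have hwlo : w ∣ lo := (Dvd.intro_left 2 (by ring)).trans hdvd
    refine ⟨n - min (lo + (w + w)) n,
      8 + (10 + (K * (min (lo + (w + w)) n - lo) + 2)), ?_, ?_⟩
    · have h1 : n - lo = (min (lo + (w + w)) n - lo) + (n - min (lo + (w + w)) n) := by omega
      have h2 : 1 ≤ min (lo + (w + w)) n - lo := by omega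
      rw [h1]
      generalize min (lo + (w + w)) n - lo = x at *
      simp only [Test.cost, NExp.cost]
      nlinarith
    · refine Halts.seq (B₁ := 8) (.exec (Q := fun ρ => ρ = σ.setN 5 (min (lo + w) n)) rfl
        (by simp [Program.time, NExp.cost]) ?_) ?_ le_rfl
      · simp only [Program.exec, NExp.val, h0, h3, ← hlo]; congr 1; omega
      rintro _ - rfl
      refine Halts.seq (B₁ := 10) (.exec (Q := fun ρ => ρ = (σ.setN 5 (min (lo + w) n)).setN 6
        (min (lo + (w + w)) n)) rfl (by simp [Program.time, NExp.cost]) ?_) ?_ le_rfl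
      · simp only [Program.exec, NExp.val, Memory.setN_nvar]; simp [h0, h3, ← hlo]; congr 1; omega
      rintro _ - rfl
      have hsegs : ∀ a b, seg σ a b →
          seg ((σ.setN 5 (min (lo + w) n)).setN 6 (min (lo + (w + w)) n)) a b := fun a b h =>
        hseg _ _ _ _ _ (by norm_num) (by norm_num) (hseg _ _ _ _ _ (by norm_num) (by norm_num) h)
      refine Halts.seq (hbody _ lo (min (lo + w) n) (min (lo + (w + w)) n)
        (hI _ _ _ (by norm_num) (by norm_num) (hI _ _ _ (by norm_num) (by norm_num) hIσ))
        (by simp [h0]) (by simp [hlo]) (by simp) (by simp) (by omega) (by omega) (by omega)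
        (hsegs _ _ (htodo lo hwlo le_rfl hb)) ?_) ?_ le_rfl
      · by_cases hlt : lo + w < n
        · have := htodo (lo + w) (hwlo.add dvd_rfl) (by omega) hlt
          refine hsegs _ _ ?_
          rwa [min_eq_left hlt.le, ← add_assoc]
        -- The last block has no right neighbour: both limits are clipped to `n` and the right half
        -- is empty.
        · rw [min_eq_right (by omega), min_eq_right (by omega)]
          exact hempty _ _
      · rintro ρ hF ⟨hIρ, hρ, hother⟩
        have e0 : ρ.nvar 0 = n := by
          rw [hF.nvar 0 fun h => (hnv _ h).1 rfl]; simp [h0]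
        have e3 : ρ.nvar 3 = w := by
          rw [hF.nvar 3 fun h => (hnv _ h).2.1 rfl]; simp [h3]
        have e6 : ρ.nvar 6 = min (lo + (w + w)) n := by
          rw [hF.nvar 6 fun h => (hnv _ h).2.2.2 rfl]; simp
        refine .exec rfl (by simp [Program.time, NExp.cost]) ?_
        simp only [Program.exec, NExp.val, e6, Memory.setN_nvar, if_true]
        refine ⟨hI _ _ _ (by norm_num) (by norm_num) hIρ, by simp [e0], by simp [e3], trivial, ?_, ?_, ?_⟩
        · rcases le_or_gt n (lo + (w + w)) with h | h
          · left; omega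
          · right
            rw [min_eq_left h.le]
            exact ⟨h, hdvd.add dvd_rfl⟩
        · intro a ha hlt
          refine hseg _ _ _ _ _ (by norm_num) (by norm_num) ?_
          rcases lt_trichotomy a lo with h | rfl | h
          · exact hother _ _ (.inl ((min_le_left _ _).trans (add_le_of_dvd_of_lt ha hdvd h)))
              (hsegs _ _ (hdone a ha h))
          · exact hρ
          · have := add_le_of_dvd_of_lt hdvd ha h
            omega
        · intro a ha hle hlt
          exact hseg _ _ _ _ _ (by norm_num) (by norm_num)
            (hother _ _ (.inr hle) (hsegs _ _ (htodo a ha (by omega) hlt)))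
  · rintro τ - ⟨⟨r, hIτ, h0, h3, -, h4, hdone, -⟩, hb⟩
    simp only [Test.Holds, NExp.val, h0] at hb
    exact ⟨hIτ, h0, h3, fun a ha hlt => hdone a ha (by omega)⟩

/-- The width runs through the powers `2 ^ e`, so `Nat.clog 2 n - e` passes remain; once the width
reaches `n`, the block at `0` is everything. -/
theorem bottomUp_halts (hnv : ∀ i ∈ body.nvars, i ≠ 0 ∧ i ≠ 3 ∧ i ≠ 4 ∧ i ≠ 6)
    (hI : ∀ σ i m, 3 ≤ i → i ≤ 6 → I σ → I (σ.setN i m))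
    (hseg : ∀ σ i m a b, 3 ≤ i → i ≤ 6 → seg σ a b → seg (σ.setN i m) a b)
    (hempty : ∀ σ a, seg σ a a)
    (hbody : ∀ σ lo mid hi, I σ → σ.nvar 0 = n → σ.nvar 4 = lo → σ.nvar 5 = mid →
      σ.nvar 6 = hi → lo < mid → mid ≤ hi → hi ≤ n → seg σ lo mid → seg σ mid hi →
      Halts body σ (K * (hi - lo)) fun τ => I τ ∧ seg τ lo hi ∧
        ∀ a b, b ≤ lo ∨ hi ≤ a → seg σ a b → seg τ a b)
    {σ₀ : Memory} (hn : 0 < n) (h0 : σ₀.nvar 0 = n) (hI0 : I σ₀)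
    (hs : ∀ a, a < n → seg σ₀ a (a + 1)) :
    Halts (bottomUp body) σ₀ (((K + 30) * n + 20) * Nat.clog 2 n + 6) fun τ =>
      I τ ∧ τ.nvar 0 = n ∧ seg τ 0 n := by
  refine Halts.seq (B₁ := 2) (.exec (Q := fun ρ => ρ = σ₀.setN 3 1) rfl le_rfl rfl)
    (B₂ := ((K + 30) * n + 20) * Nat.clog 2 n + 4) ?_ (by omega)
  rintro _ - rfl
  refine (Halts.loop (K := (K + 30) * n + 20) (r₀ := Nat.clog 2 n) (fun r σ => I σ ∧
    σ.nvar 0 = n ∧ (∃ e, σ.nvar 3 = 2 ^ e ∧ r = Nat.clog 2 n - e) ∧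
    ∀ a, σ.nvar 3 ∣ a → a < n → seg σ a (min (a + σ.nvar 3) n)) ?_ ?_).mono
    (by simp [Test.cost, NExp.cost]) ?_
  · refine ⟨hI _ _ _ (by norm_num) (by norm_num) hI0, by simp [h0], ⟨0, by simp, rfl⟩, ?_⟩
    intro a _ ha
    simp only [Memory.setN_nvar, if_true]
    rw [min_eq_left (by omega)]
    exact hseg _ _ _ _ _ (by norm_num) (by norm_num) (hs a ha)
  · rintro r σ ⟨hIσ, h0, ⟨e, he, rfl⟩, hblocks⟩ - hb
    simp only [Test.Holds, NExp.val, h0, he] at hb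
    rw [he] at hblocks
    have hlt : e < Nat.clog 2 n := by
      by_contra hcon
      have := (Nat.clog_le_iff_le_pow (by norm_num : 1 < 2)).1 (not_lt.1 hcon)
      omega
    refine ⟨Nat.clog 2 n - (e + 1), 2 + (((K + 30) * n + 4) + 4), ?_, ?_⟩
    · have : Nat.clog 2 n - e = (Nat.clog 2 n - (e + 1)) + 1 := by omega
      rw [this, mul_add]
      simp only [Test.cost, NExp.cost]
      omega
    · refine Halts.seq (B₁ := 2) (.exec (Q := fun ρ => ρ = σ.setN 4 0) rfl le_rfl rfl) ?_ le_rfl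
      rintro _ - rfl
      refine Halts.seq (bottomUpInner_halts hnv hI hseg hempty hbody (w := 2 ^ e) (by positivity)
        (by simp [h0]) (by simp [he]) (by simp) (hI _ _ _ (by norm_num) (by norm_num) hIσ)
        fun a h h' => hseg _ _ _ _ _ (by norm_num) (by norm_num) (hblocks a h h')) ?_ le_rfl
      rintro ρ - ⟨hIρ, r0, r3, hρ⟩
      refine .exec rfl (by simp [Program.time, NExp.cost]) ?_
      simp only [Program.exec, NExp.val, r3]
      refine ⟨hI _ _ _ (by norm_num) (by norm_num) hIρ, by simp [r0],
        ⟨e + 1, by simp [pow_succ, mul_two], rfl⟩, ?_⟩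
      simp only [Memory.setN_nvar, if_true]
      exact fun a h h' => hseg _ _ _ _ _ (by norm_num) (by norm_num) (hρ a h h')
  · rintro τ - ⟨⟨r, hIτ, h0, -, hblocks⟩, hb⟩
    simp only [Test.Holds, NExp.val, h0] at hb
    refine ⟨hIτ, h0, ?_⟩
    have := hblocks 0 (dvd_zero _) hn
    rwa [min_eq_right (by omega)] at this

end BottomUp

end RealRAM

/-! ### Merging sorted blocks -/

namespace RealRAM

/-- The sequence `f` is nondecreasing on `[lo, hi)`. -/
def SortedOn (f : ℕ → ℝ) (lo hi : ℕ) : Prop := ∀ a b, lo ≤ a → a ≤ b → b < hi → f a ≤ f b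

/-- The merge of `[lo, mid)` and `[mid, hi)` has consumed the entries of `α` up to `i` and up to
`j` and has produced the entries of `β` up to `k`. -/
structure MergeState (κ : ℕ → ℝ) (α : ℕ → ℕ) (lo mid hi i j k : ℕ) (β : ℕ → ℕ) : Prop where
  lo_le : lo ≤ i
  le_mid : i ≤ mid
  mid_le : mid ≤ j
  le_hi : j ≤ hi
  count : k + mid = i + j
  placed : ∀ l, lo ≤ l → l < i ∨ mid ≤ l ∧ l < j → ∃ k', lo ≤ k' ∧ k' < k ∧ β k' = α l
  sorted : SortedOn (fun l => κ (β l)) lo k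
  bound : ∀ k' l, lo ≤ k' → k' < k → i ≤ l ∧ l < mid ∨ j ≤ l ∧ l < hi → κ (β k') ≤ κ (α l)

namespace MergeState

variable {κ : ℕ → ℝ} {α β : ℕ → ℕ} {lo mid hi i j k : ℕ}

theorem init (h : lo ≤ mid) (h' : mid ≤ hi) : MergeState κ α lo mid hi lo mid lo β :=
  ⟨le_rfl, h, le_rfl, h', by omega, fun l _ _ => by omega, fun a b _ _ _ => by omega,
    fun k' l _ _ => by omega⟩

/-- By `bound`, any unconsumed entry may be appended without breaking sortedness; choosing a least
one matters only for keeping `bound`. -/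
theorem sorted_update (h : MergeState κ α lo mid hi i j k β) {l : ℕ}
    (hl : i ≤ l ∧ l < mid ∨ j ≤ l ∧ l < hi) :
    SortedOn (fun m => κ (Function.update β k (α l) m)) lo (k + 1) := by
  intro a b ha hab hb
  simp only [Function.update_apply]
  rcases eq_or_ne b k with rfl | hbk
  · rcases eq_or_ne a b with rfl | hak
    · exact le_rfl
    · simpa [hak] using h.bound a l ha (by omega) hl
  · rw [if_neg (by omega), if_neg hbk]
    exact h.sorted a b ha hab (by omega)

theorem placed_update (h : MergeState κ α lo mid hi i j k β) (m : ℕ) {l : ℕ} (hl : lo ≤ l)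
    (hl' : l < i ∨ mid ≤ l ∧ l < j) :
    ∃ k', lo ≤ k' ∧ k' < k + 1 ∧ Function.update β k m k' = α l := by
  obtain ⟨k', h1, h2, h3⟩ := h.placed l hl hl'
  exact ⟨k', h1, by omega, by rw [Function.update_of_ne (by omega), h3]⟩

theorem left (h : MergeState κ α lo mid hi i j k β) (hs : SortedOn (fun l => κ (α l)) lo mid)
    (hi' : i < mid) (hle : ∀ l, j ≤ l → l < hi → κ (α i) ≤ κ (α l)) :
    MergeState κ α lo mid hi (i + 1) j (k + 1) (Function.update β k (α i)) := by
  have h1 := h.lo_le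
  have h2 := h.mid_le
  have h3 := h.count
  refine ⟨by omega, hi', h2, h.le_hi, by omega, fun l hl hl' => ?_,
    h.sorted_update (.inl ⟨le_rfl, hi'⟩), fun k' l hk hk' hl => ?_⟩
  · rcases eq_or_ne l i with rfl | hne
    · exact ⟨k, by omega, by omega, by simp⟩
    · exact h.placed_update _ hl (by omega)
  · rcases eq_or_ne k' k with rfl | hne
    · simp only [Function.update_self]
      rcases hl with hl | hl
      · exact hs i l h1 (by omega) hl.2
      · exact hle l hl.1 hl.2
    · rw [Function.update_of_ne hne]
      exact h.bound k' l hk (by omega) (by omega)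

theorem right (h : MergeState κ α lo mid hi i j k β) (hs : SortedOn (fun l => κ (α l)) mid hi)
    (hj : j < hi) (hle : ∀ l, i ≤ l → l < mid → κ (α j) ≤ κ (α l)) :
    MergeState κ α lo mid hi i (j + 1) (k + 1) (Function.update β k (α j)) := by
  have h1 := h.lo_le
  have h2 := h.mid_le
  have h3 := h.count
  refine ⟨h1, h.le_mid, by omega, hj, by omega, fun l hl hl' => ?_,
    h.sorted_update (.inr ⟨le_rfl, hj⟩), fun k' l hk hk' hl => ?_⟩
  · rcases eq_or_ne l j with rfl | hne
    · exact ⟨k, by omega, by omega, by simp⟩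
    · exact h.placed_update _ hl (by omega)
  · rcases eq_or_ne k' k with rfl | hne
    · simp only [Function.update_self]
      rcases hl with hl | hl
      · exact hle l hl.1 hl.2
      · exact hs j l h2 (by omega) hl.2
    · rw [Function.update_of_ne hne]
      exact h.bound k' l hk (by omega) (by omega)

end MergeState

/-- One step of a merge from array `A` to array `1`, with keys from real array `key`. -/
def mergeBody (A key : ℕ) : Program :=
  .seq
    -- The left head is taken unless the left block is exhausted or the right head is strictly
    -- smaller. Memory is total, so reading keys past the end of a block is harmless.
    (.ite (.conj (.natLt (.var 7) (.var 5)) (.neg (.conj (.natLt (.var 8) (.var 6))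
        (.realLt (.cell key (.cell A (.var 8))) (.cell key (.cell A (.var 7)))))))
      (.seq (.storeN 1 (.var 9) (.cell A (.var 7))) (.setN 7 (.plus (.var 7) (.const 1))))
      (.seq (.storeN 1 (.var 9) (.cell A (.var 8))) (.setN 8 (.plus (.var 8) (.const 1)))))
    (.setN 9 (.plus (.var 9) (.const 1)))

/-- Copies the entries of array `1` on `[lo, hi)` to array `A`. -/
def copyLoop (A : ℕ) : Program :=
  .loop (.natLt (.var 9) (.var 6))
    (.seq (.storeN A (.var 9) (.cell 1 (.var 9))) (.setN 9 (.plus (.var 9) (.const 1))))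

/-- Merges the blocks `[lo, mid)` and `[mid, hi)` of array `A`. -/
def merge (A key : ℕ) : Program :=
  .seq (.setN 9 (.var 4)) (.seq (.setN 7 (.var 4)) (.seq (.setN 8 (.var 5))
    (.seq (.loop (.natLt (.var 9) (.var 6)) (mergeBody A key))
      (.seq (.setN 9 (.var 4)) (copyLoop A)))))

theorem mergeLoop_halts {A key : ℕ} (hA : A ≠ 1) {σ₀ : Memory} {lo mid hi : ℕ}
    (h5 : σ₀.nvar 5 = mid) (h6 : σ₀.nvar 6 = hi) (h7 : σ₀.nvar 7 = lo) (h8 : σ₀.nvar 8 = mid)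
    (h9 : σ₀.nvar 9 = lo) (hlm : lo ≤ mid) (hmh : mid ≤ hi)
    (hs1 : SortedOn (fun l => σ₀.rarr key (σ₀.narr A l)) lo mid)
    (hs2 : SortedOn (fun l => σ₀.rarr key (σ₀.narr A l)) mid hi) :
    Halts (.loop (.natLt (.var 9) (.var 6)) (mergeBody A key)) σ₀ (60 * (hi - lo) + 4) fun τ =>
      MergeState (σ₀.rarr key) (σ₀.narr A) lo mid hi mid hi hi (τ.narr 1) := by
  refine (Halts.loop (K := 60) (r₀ := hi - lo) (fun r σ => r = hi - σ.nvar 9 ∧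
    MergeState (σ₀.rarr key) (σ₀.narr A) lo mid hi (σ.nvar 7) (σ.nvar 8) (σ.nvar 9) (σ.narr 1))
    ?_ ?_).mono (by simp [Test.cost, NExp.cost]) ?_
  · rw [h7, h8, h9]
    exact ⟨rfl, .init hlm hmh⟩
  · rintro r σ ⟨rfl, hM⟩ hF hb
    have e5 : σ.nvar 5 = mid := (hF.nvar 5 (by simp [mergeBody, Program.nvars])).trans h5
    have e6 : σ.nvar 6 = hi := (hF.nvar 6 (by simp [mergeBody, Program.nvars])).trans h6
    have eA : σ.narr A = σ₀.narr A := hF.narr A (by simp [mergeBody, Program.narrs, hA])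
    have eR : σ.rarr = σ₀.rarr := funext fun a => hF.rarr a (by simp [mergeBody, Program.rarrs])
    simp only [Test.Holds, NExp.val, e6] at hb
    refine ⟨hi - (σ.nvar 9 + 1), 50, ?_, ?_⟩
    · simp only [Test.cost, NExp.cost]; omega
    · refine .exec rfl (by simp [mergeBody, Program.time, NExp.cost, Test.cost, RExp.cost]) ?_
      simp only [mergeBody, Program.exec, Test.Holds, NExp.val, RExp.val, e5, e6, eA, eR]
      have hcount := hM.count
      have hle := hM.le_hi
      have hlm := hM.le_mid
      split_ifs with hc
      · obtain ⟨hc1, hc2⟩ := hc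
        refine ⟨by simp, ?_⟩
        simp only [Memory.setN_nvar, Memory.setN_narr, Memory.storeN_narr, Memory.storeN_nvar,
          if_true]
        norm_num
        refine hM.left hs1 hc1 fun l hl hl' => ?_
        rw [not_and, not_lt] at hc2
        exact (hc2 (by omega)).trans (hs2 _ _ hM.mid_le hl hl')
      · refine ⟨by simp, ?_⟩
        simp only [Memory.setN_nvar, Memory.setN_narr, Memory.storeN_narr, Memory.storeN_nvar,
          if_true]
        norm_num
        refine hM.right hs2 ?_ fun l hl hl' => ?_
        · by_contra hcon
          exact hc ⟨by omega, fun h => hcon h.1⟩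
        · rw [not_and, not_not] at hc
          exact (hc (by omega)).2.le.trans (hs1 _ _ hM.lo_le hl hl')
  · rintro τ hF ⟨⟨r, -, hM⟩, hb⟩
    have e6 : τ.nvar 6 = hi := (hF.nvar 6 (by simp [mergeBody, Program.nvars])).trans h6
    simp only [Test.Holds, NExp.val, e6] at hb
    have h1 := hM.count
    have h2 := hM.le_hi
    have h3 := hM.le_mid
    -- With the output full, `count` forces both blocks to be exhausted.
    have e7 : τ.nvar 7 = mid := by omega
    have e8 : τ.nvar 8 = hi := by omega
    have e9 : τ.nvar 9 = hi := by omega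
    rwa [e7, e8, e9] at hM

theorem copyLoop_halts {A : ℕ} (hA : A ≠ 1) {σ₀ : Memory} {lo hi : ℕ} (h6 : σ₀.nvar 6 = hi)
    (h9 : σ₀.nvar 9 = lo) (hlh : lo ≤ hi) :
    Halts (copyLoop A) σ₀ (20 * (hi - lo) + 4) fun τ =>
      ∀ l, τ.narr A l = if lo ≤ l ∧ l < hi then σ₀.narr 1 l else σ₀.narr A l := by
  refine (Halts.loop (K := 20) (r₀ := hi - lo) (fun r σ => r = hi - σ.nvar 9 ∧ lo ≤ σ.nvar 9 ∧
    σ.nvar 9 ≤ hi ∧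
    ∀ l, σ.narr A l = if lo ≤ l ∧ l < σ.nvar 9 then σ₀.narr 1 l else σ₀.narr A l)
    ?_ ?_).mono (by simp [Test.cost, NExp.cost]) ?_
  · refine ⟨by rw [h9], h9.ge, by omega, fun l => ?_⟩
    rw [if_neg (by omega)]
  · rintro r σ ⟨rfl, h1, h2, hl⟩ hF hb
    have e6 : σ.nvar 6 = hi := (hF.nvar 6 (by simp [Program.nvars])).trans h6
    have e1 : σ.narr 1 = σ₀.narr 1 := hF.narr 1 (by simp [Program.narrs, hA.symm])
    simp only [Test.Holds, NExp.val, e6] at hb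
    refine ⟨hi - (σ.nvar 9 + 1), 12, ?_, ?_⟩
    · simp only [Test.cost, NExp.cost]; omega
    · refine .exec rfl (by simp [Program.time, NExp.cost]) ?_
      simp only [Program.exec, NExp.val, Memory.setN_nvar, Memory.setN_narr, Memory.storeN_nvar,
        Memory.storeN_narr, if_true, e1]
      refine ⟨trivial, by omega, by omega, fun l => ?_⟩
      rcases eq_or_ne l (σ.nvar 9) with rfl | hne
      · rw [Function.update_self, if_pos (by omega)]
      · rw [Function.update_of_ne hne, hl]
        exact if_congr (by omega) rfl rfl
  · rintro τ hF ⟨⟨r, -, h1, h2, hl⟩, hb⟩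
    have e6 : τ.nvar 6 = hi := (hF.nvar 6 (by simp [Program.nvars])).trans h6
    simp only [Test.Holds, NExp.val, e6] at hb
    have e9 : τ.nvar 9 = hi := by omega
    rwa [e9] at hl

/-- It is enough to say that every old entry still occurs in the block; that the block is a
rearrangement then follows by counting, in `PermBelow.rearrange`. -/
theorem merge_halts {A key : ℕ} (hA : A ≠ 1) {σ₀ : Memory} {lo mid hi : ℕ}
    (h4 : σ₀.nvar 4 = lo) (h5 : σ₀.nvar 5 = mid) (h6 : σ₀.nvar 6 = hi) (hlm : lo < mid)
    (hmh : mid ≤ hi) (hs1 : SortedOn (fun l => σ₀.rarr key (σ₀.narr A l)) lo mid)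
    (hs2 : SortedOn (fun l => σ₀.rarr key (σ₀.narr A l)) mid hi) :
    Halts (merge A key) σ₀ (100 * (hi - lo)) fun τ =>
      SortedOn (fun l => σ₀.rarr key (τ.narr A l)) lo hi ∧
      (∀ l, lo ≤ l → l < hi → ∃ l', lo ≤ l' ∧ l' < hi ∧ τ.narr A l' = σ₀.narr A l) ∧
      ∀ l, l < lo ∨ hi ≤ l → τ.narr A l = σ₀.narr A l := by
  have hB : 2 + (2 + (2 + ((60 * (hi - lo) + 4) + (2 + (20 * (hi - lo) + 4))))) ≤
    100 * (hi - lo) := by omega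
  refine Halts.seq (B₁ := 2) (.exec (Q := fun ρ => ρ = σ₀.setN 9 lo) rfl le_rfl
    (by simp [Program.exec, NExp.val, h4])) ?_ hB
  rintro _ - rfl
  refine Halts.seq (B₁ := 2) (.exec (Q := fun ρ => ρ = (σ₀.setN 9 lo).setN 7 lo) rfl le_rfl
    (by simp [Program.exec, NExp.val, h4])) ?_ le_rfl
  rintro _ - rfl
  refine Halts.seq (B₁ := 2) (.exec (Q := fun ρ => ρ = ((σ₀.setN 9 lo).setN 7 lo).setN 8 mid) rfl
    le_rfl (by simp [Program.exec, NExp.val, h5])) ?_ le_rfl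
  rintro _ - rfl
  refine Halts.seq (mergeLoop_halts hA (lo := lo) (mid := mid) (hi := hi) (by simp [h5])
    (by simp [h6]) (by simp) (by simp) (by simp) hlm.le hmh hs1 hs2) ?_ le_rfl
  rintro ρ hF hM
  have e4 : ρ.nvar 4 = lo := (hF.nvar 4 (by simp [mergeBody, Program.nvars])).trans (by simp [h4])
  have e6 : ρ.nvar 6 = hi := (hF.nvar 6 (by simp [mergeBody, Program.nvars])).trans (by simp [h6])
  have eA : ρ.narr A = σ₀.narr A := hF.narr A (by simp [mergeBody, Program.narrs, hA])
  refine Halts.seq (B₁ := 2) (.exec (Q := fun τ => τ = ρ.setN 9 lo) rfl le_rfl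
    (by simp [Program.exec, NExp.val, e4])) ?_ le_rfl
  rintro _ - rfl
  refine (copyLoop_halts hA (lo := lo) (hi := hi) (by simp [e6]) (by simp) (by omega)).mono le_rfl ?_
  rintro τ - hτ
  simp only [Memory.setN_narr, Memory.setN_rarr, eA] at hτ hM
  refine ⟨fun a b ha hab hb => ?_, fun l hl hl' => ?_, fun l hl => ?_⟩
  · simp only [hτ]
    rw [if_pos (by omega), if_pos (by omega)]
    exact hM.sorted a b ha hab hb
  · obtain ⟨k, h1, h2, h3⟩ := hM.placed l hl (by omega)
    exact ⟨k, h1, h2, by rw [hτ, if_pos ⟨h1, h2⟩, h3]⟩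
  · rw [hτ, if_neg (by omega)]

end RealRAM

/-! ### Weights of triples, packing and the strip -/

/-- Total pairwise `L₁` distance of the points with indices `i`, `j`, `k`. -/
noncomputable def triWeight (x y : ℕ → ℝ) (i j k : ℕ) : ℝ :=
  |x i - x j| + |y i - y j| + (|x i - x k| + |y i - y k|) + (|x j - x k| + |y j - y k|)

theorem triWeight_swap (x y : ℕ → ℝ) (i j k : ℕ) : triWeight x y j i k = triWeight x y i j k := by
  simp only [triWeight, abs_sub_comm (x j) (x i), abs_sub_comm (y j) (y i)]
  ring

theorem triWeight_rotate (x y : ℕ → ℝ) (i j k : ℕ) :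
    triWeight x y j k i = triWeight x y i j k := by
  simp only [triWeight, abs_sub_comm (x j) (x i), abs_sub_comm (y j) (y i),
    abs_sub_comm (x k) (x i), abs_sub_comm (y k) (y i)]
  ring

/-- The weight contains the direct path from `i` to `j` and the path through `k`, and each covers
`|x i - x j|`. -/
theorem two_mul_abs_sub_fst_le_triWeight (x y : ℕ → ℝ) (i j k : ℕ) :
    2 * |x i - x j| ≤ triWeight x y i j k := by
  have h := abs_sub_le (x i) (x k) (x j)
  rw [abs_sub_comm (x k)] at h
  rw [triWeight]
  linarith [abs_nonneg (y i - y j), abs_nonneg (y i - y k), abs_nonneg (y j - y k)]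

theorem two_mul_abs_sub_snd_le_triWeight (x y : ℕ → ℝ) (i j k : ℕ) :
    2 * |y i - y j| ≤ triWeight x y i j k := by
  have h := abs_sub_le (y i) (y k) (y j)
  rw [abs_sub_comm (y k)] at h
  rw [triWeight]
  linarith [abs_nonneg (x i - x j), abs_nonneg (x i - x k), abs_nonneg (x j - x k)]

/-- All triples of distinct indices in `M` have weight at least `D`. -/
def TriplesGE (x y : ℕ → ℝ) (D : ℝ) (M : Set ℕ) : Prop :=
  ∀ i ∈ M, ∀ j ∈ M, ∀ k ∈ M, i ≠ j → i ≠ k → j ≠ k → D ≤ triWeight x y i j k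

theorem TriplesGE.mono {x y : ℕ → ℝ} {D D' : ℝ} {M M' : Set ℕ} (h : TriplesGE x y D M)
    (hD : D' ≤ D) (hM : M' ⊆ M) : TriplesGE x y D' M' :=
  fun i hi j hj k hk h1 h2 h3 => hD.trans (h i (hM hi) j (hM hj) k (hM hk) h1 h2 h3)

theorem TriplesGE.insert {x y : ℕ → ℝ} {D : ℝ} {M : Set ℕ} {q : ℕ} (h : TriplesGE x y D M)
    (hq : ∀ a ∈ M, ∀ b ∈ M, a ≠ b → a ≠ q → b ≠ q → D ≤ triWeight x y a b q) :
    TriplesGE x y D (insert q M) := by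
  rintro i (rfl | hi) j (rfl | hj) k (rfl | hk) h1 h2 h3
  · exact absurd rfl h1
  · exact absurd rfl h1
  · exact absurd rfl h2
  · rw [← triWeight_rotate]; exact hq j hj k hk h3 h1.symm h2.symm
  · exact absurd rfl h3
  · rw [← triWeight_rotate, ← triWeight_rotate]; exact hq k hk i hi h2.symm h3.symm h1
  · exact hq i hi j hj h1 h2 h3
  · exact h i hi j hj k hk h1 h2 h3

/-- Three numbers in a half-open interval of length `h` differ by less than `2 * h` in total. -/
theorem abs_sub_add_abs_sub_add_abs_sub_lt {a b c u h : ℝ} (ha : u ≤ a ∧ a < u + h)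
    (hb : u ≤ b ∧ b < u + h) (hc : u ≤ c ∧ c < u + h) :
    |a - b| + |a - c| + |b - c| < 2 * h := by
  obtain ⟨ha, ha'⟩ := ha
  obtain ⟨hb, hb'⟩ := hb
  obtain ⟨hc, hc'⟩ := hc
  rcases abs_cases (a - b) with h1 | h1 <;> rcases abs_cases (a - c) with h2 | h2 <;>
    rcases abs_cases (b - c) with h3 | h3 <;> linarith

/-- Packing: in an `h × h` box (in corner coordinates `f`, `g`) there are at most `8` points
if all their triples have weight at least `2 * h`. -/
theorem TriplesGE.card_le_eight {x y f g : ℕ → ℝ} {h : ℝ} {N : Finset ℕ}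
    (hN : TriplesGE x y (2 * h) N) (hf : ∀ i ∈ N, 0 ≤ f i ∧ f i < h)
    (hg : ∀ i ∈ N, 0 ≤ g i ∧ g i < h) (hx : ∀ i ∈ N, ∀ j ∈ N, |x i - x j| = |f i - f j|)
    (hy : ∀ i ∈ N, ∀ j ∈ N, |y i - y j| = |g i - g j|) : N.card ≤ 8 := by
  classical
  by_contra! hcard
  -- Pigeonhole on the four quadrants of side `h / 2`: more than `8` points put three into one
  -- quadrant, where each coordinate contributes less than `h` to the weight.
  obtain ⟨c, -, hc⟩ := Finset.exists_lt_card_fiber_of_mul_lt_card_of_maps_to (n := 2)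
    (f := fun i => (decide (f i < h / 2), decide (g i < h / 2))) (s := N)
    (t := (Finset.univ : Finset (Bool × Bool))) (fun _ _ => Finset.mem_univ _)
    (by simpa using hcard)
  obtain ⟨i, hi, j, hj, k, hk, hij, hik, hjk⟩ := Finset.two_lt_card.1 hc
  simp only [Finset.mem_filter] at hi hj hk
  have cell : ∀ (f : ℕ → ℝ), (0 ≤ f i ∧ f i < h) → (0 ≤ f j ∧ f j < h) → (0 ≤ f k ∧ f k < h) →
      decide (f i < h / 2) = decide (f j < h / 2) → decide (f i < h / 2) = decide (f k < h / 2) →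
      |f i - f j| + |f i - f k| + |f j - f k| < 2 * (h / 2) := by
    intro f hi hj hk hij hik
    rw [decide_eq_decide] at hij hik
    by_cases hlt : f i < h / 2
    · exact abs_sub_add_abs_sub_add_abs_sub_lt (u := 0) ⟨hi.1, by linarith⟩
        ⟨hj.1, by linarith [hij.1 hlt]⟩ ⟨hk.1, by linarith [hik.1 hlt]⟩
    · exact abs_sub_add_abs_sub_add_abs_sub_lt (u := h / 2) ⟨not_lt.1 hlt, by linarith⟩
        ⟨not_lt.1 (mt hij.2 hlt), by linarith⟩ ⟨not_lt.1 (mt hik.2 hlt), by linarith⟩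
  have e1 := congrArg Prod.fst (hi.2.trans hj.2.symm)
  have e2 := congrArg Prod.fst (hi.2.trans hk.2.symm)
  have e3 := congrArg Prod.snd (hi.2.trans hj.2.symm)
  have e4 := congrArg Prod.snd (hi.2.trans hk.2.symm)
  have h1 := cell f (hf i hi.1) (hf j hj.1) (hf k hk.1) e1 e2
  have h2 := cell g (hg i hi.1) (hg j hj.1) (hg k hk.1) e3 e4
  have h3 := hN i hi.1 j hj.1 k hk.1 hij hik hjk
  rw [triWeight, hx i hi.1 j hj.1, hx i hi.1 k hk.1, hx j hj.1 k hk.1, hy i hi.1 j hj.1,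
    hy i hi.1 k hk.1, hy j hj.1 k hk.1] at h3
  linarith

/-- Two index sets on the two sides of the vertical line at `xm`, each without triples of
weight less than `D`. -/
structure Sides (x y : ℕ → ℝ) (D xm : ℝ) (L R : Set ℕ) : Prop where
  left_le : ∀ i ∈ L, x i ≤ xm
  le_right : ∀ i ∈ R, xm ≤ x i
  left : TriplesGE x y D L
  right : TriplesGE x y D R

namespace Sides

variable {x y : ℕ → ℝ} {D xm : ℝ} {L R : Set ℕ}

/-- A triple within one side is heavy by assumption. Otherwise a far point has a partner across the
line, so their `x`-coordinates differ by at least `D / 2`. -/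
theorem le_triWeight_of_far (hs : Sides x y D xm L R) {a b q : ℕ} (ha : a ∈ L ∪ R)
    (hb : b ∈ L ∪ R) (hq : q ∈ L ∪ R) (hab : a ≠ b) (haq : a ≠ q) (hbq : b ≠ q)
    (hfar : D ≤ 2 * |x a - xm| ∨ D ≤ 2 * |x b - xm| ∨ D ≤ 2 * |x q - xm|) :
    D ≤ triWeight x y a b q := by
  have h1 := two_mul_abs_sub_fst_le_triWeight x y a b q
  have h2 := two_mul_abs_sub_fst_le_triWeight x y b q a
  have h3 := two_mul_abs_sub_fst_le_triWeight x y q a b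
  rw [triWeight_rotate] at h2
  rw [triWeight_rotate, triWeight_rotate] at h3
  have a1 := le_abs_self (x a - x b)
  have a2 := neg_le_abs (x a - x b)
  have a3 := le_abs_self (x b - x q)
  have a4 := neg_le_abs (x b - x q)
  have a5 := le_abs_self (x q - x a)
  have a6 := neg_le_abs (x q - x a)
  by_cases hL : a ∈ L ∧ b ∈ L ∧ q ∈ L
  · exact hs.left a hL.1 b hL.2.1 q hL.2.2 hab haq hbq
  by_cases hR : a ∈ R ∧ b ∈ R ∧ q ∈ R
  · exact hs.right a hR.1 b hR.2.1 q hR.2.2 hab haq hbq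
  replace hL : a ∈ L → b ∈ L → q ∈ L → False := fun h1 h2 h3 => hL ⟨h1, h2, h3⟩
  replace hR : a ∈ R → b ∈ R → q ∈ R → False := fun h1 h2 h3 => hR ⟨h1, h2, h3⟩
  rcases ha with ha | ha <;> rcases hb with hb | hb <;> rcases hq with hq | hq <;>
  first
  | exact (hL ha hb hq).elim
  | exact (hR ha hb hq).elim
  | first
    | have b1 := hs.left_le a ha
    | have b1 := hs.le_right a ha
    first
    | have b2 := hs.left_le b hb
    | have b2 := hs.le_right b hb
    first
    | have b3 := hs.left_le q hq
    | have b3 := hs.le_right q hq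
    rcases hfar with h | h | h
    · rcases abs_cases (x a - xm) with h' | h' <;> linarith
    · rcases abs_cases (x b - xm) with h' | h' <;> linarith
    · rcases abs_cases (x q - xm) with h' | h' <;> linarith

/-- The points lie in two squares of side `D / 2` that hang below the height `yq`, to the left and
to the right of the line. Measuring from the common corner on the line lets the packing bound with
`h = D / 2` serve both. -/
theorem card_le_sixteen (hs : Sides x y D xm L R) {N : Finset ℕ} {yq : ℝ}
    (hN : ∀ i ∈ N, i ∈ L ∪ R) (hx : ∀ i ∈ N, 2 * |x i - xm| < D)
    (hy : ∀ i ∈ N, y i ≤ yq ∧ 2 * (yq - y i) < D) : N.card ≤ 16 := by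
  classical
  have h1 : (N.filter (· ∈ L)).card ≤ 8 := by
    refine TriplesGE.card_le_eight (x := x) (y := y) (f := fun i => xm - x i)
      (g := fun i => yq - y i) (h := D / 2)
      (hs.left.mono (by linarith) fun i hi => (Finset.mem_filter.1 hi).2) ?_ ?_ ?_ ?_
    · intro i hi
      rw [Finset.mem_filter] at hi
      have := hs.left_le i hi.2
      exact ⟨by linarith, by linarith [hx i hi.1, neg_le_abs (x i - xm)]⟩
    · intro i hi
      rw [Finset.mem_filter] at hi
      exact ⟨by linarith [hy i hi.1], by linarith [hy i hi.1]⟩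
    · intro i _ j _
      rw [← abs_neg]; congr 1; ring
    · intro i _ j _
      rw [← abs_neg]; congr 1; ring
  have h2 : (N.filter (· ∉ L)).card ≤ 8 := by
    have hR : ∀ i ∈ N.filter (· ∉ L), i ∈ R := fun i hi => by
      rw [Finset.mem_filter] at hi
      exact (hN i hi.1).resolve_left hi.2
    refine TriplesGE.card_le_eight (x := x) (y := y) (f := fun i => x i - xm)
      (g := fun i => yq - y i) (h := D / 2)
      (hs.right.mono (by linarith) fun i hi => hR i hi) ?_ ?_ ?_ ?_
    · intro i hi
      have := hs.le_right i (hR i hi)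
      rw [Finset.mem_filter] at hi
      exact ⟨by linarith, by linarith [hx i hi.1, le_abs_self (x i - xm)]⟩
    · intro i hi
      rw [Finset.mem_filter] at hi
      exact ⟨by linarith [hy i hi.1], by linarith [hy i hi.1]⟩
    · intro i _ j _
      congr 1; ring
    · intro i _ j _
      rw [← abs_neg]; congr 1; ring
  have := Finset.card_filter_add_card_filter_not (s := N) (· ∈ L)
  omega

end Sides

/-- The first `m` entries of `S` list the indices in `M` within `D / 2` of the vertical
line at `xm`, by nondecreasing `y`-coordinate. -/
structure StripState (x y : ℕ → ℝ) (D xm : ℝ) (M : Set ℕ) (S : ℕ → ℕ) (m : ℕ) : Prop where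
  mem : ∀ s < m, S s ∈ M
  near : ∀ s < m, 2 * |x (S s) - xm| < D
  inj : ∀ s t, s < t → t < m → S s ≠ S t
  mono : ∀ s t, s ≤ t → t < m → y (S s) ≤ y (S t)
  full : ∀ i ∈ M, 2 * |x i - xm| < D → ∃ s < m, S s = i

namespace StripState

variable {x y : ℕ → ℝ} {D xm : ℝ} {M L R : Set ℕ} {S : ℕ → ℕ} {m : ℕ}

theorem empty : StripState x y D xm ∅ S 0 :=
  ⟨by simp, by simp, by simp, by simp, by simp⟩

theorem skip (h : StripState x y D xm M S m) {q : ℕ} (hq : D ≤ 2 * |x q - xm|) :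
    StripState x y D xm (insert q M) S m := by
  refine ⟨fun s hs => .inr (h.mem s hs), h.near, h.inj, h.mono, ?_⟩
  rintro i (rfl | hi) hn
  · exact absurd hn (not_lt.2 hq)
  · exact h.full i hi hn

theorem push (h : StripState x y D xm M S m) {q : ℕ} (hq : 2 * |x q - xm| < D) (hqM : q ∉ M)
    (hy : ∀ i ∈ M, y i ≤ y q) :
    StripState x y D xm (insert q M) (Function.update S m q) (m + 1) := by
  have hlt : ∀ {s}, s < m → Function.update S m q s = S s := fun h =>
    Function.update_of_ne h.ne _ _
  refine ⟨fun s hs => ?_, fun s hs => ?_, fun s t hst ht => ?_, fun s t hst ht => ?_, ?_⟩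
  · rcases Nat.lt_succ_iff_lt_or_eq.1 hs with hs | rfl
    · rw [hlt hs]; exact .inr (h.mem s hs)
    · simp
  · rcases Nat.lt_succ_iff_lt_or_eq.1 hs with hs | rfl
    · rw [hlt hs]; exact h.near s hs
    · simpa using hq
  · rcases Nat.lt_succ_iff_lt_or_eq.1 ht with ht | rfl
    · rw [hlt ht, hlt (by omega)]; exact h.inj s t hst ht
    · rw [hlt hst, Function.update_self]
      rintro rfl
      exact hqM (h.mem s hst)
  · rcases Nat.lt_succ_iff_lt_or_eq.1 ht with ht | rfl
    · rw [hlt ht, hlt (by omega)]; exact h.mono s t hst ht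
    · rcases hst.lt_or_eq with hst | rfl
      · rw [hlt hst, Function.update_self]; exact hy _ (h.mem s hst)
      · exact le_rfl
  · rintro i (rfl | hi) hn
    · exact ⟨m, by omega, by simp⟩
    · obtain ⟨s, hs, rfl⟩ := h.full i hi hn
      exact ⟨s, by omega, hlt hs⟩

/-- A new triple with a point of the strip before the last 16 is heavy. -/
theorem le_triWeight_of_early (h : StripState x y D xm M S m) (hs : Sides x y D xm L R)
    (hM : M ⊆ L ∪ R) {q : ℕ} (hy : ∀ i ∈ M, y i ≤ y q) {s b : ℕ} (hsm : s + 16 < m) :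
    D ≤ triWeight x y (S s) b q := by
  have hw := two_mul_abs_sub_snd_le_triWeight x y q (S s) b
  rw [triWeight_rotate, triWeight_rotate] at hw
  by_contra! hcon
  have hc : 2 * (y q - y (S s)) < D := by linarith [le_abs_self (y q - y (S s))]
  -- If the triple were light, entry `s` would be less than `D / 2` below `q`, and hence so would
  -- all later entries; together these are more than 16.
  have hcard := hs.card_le_sixteen (N := (Finset.Ico s m).image S) (yq := y q) ?_ ?_ ?_
  · rw [Finset.card_image_of_injOn, Nat.card_Ico] at hcard
    · omega
    · intro t ht t' ht' he
      simp only [Finset.coe_Ico, Set.mem_Ico] at ht ht'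
      rcases lt_trichotomy t t' with hlt | rfl | hlt
      · exact absurd he (h.inj t t' hlt ht'.2)
      · rfl
      · exact absurd he.symm (h.inj t' t hlt ht.2)
  all_goals
    intro i hi
    obtain ⟨t, ht, rfl⟩ := Finset.mem_image.1 hi
    rw [Finset.mem_Ico] at ht
  · exact hM (h.mem t ht.2)
  · exact h.near t ht.2
  · exact ⟨hy _ (h.mem t ht.2), by linarith [h.mono s t ht.1 ht.2]⟩

/-- Two thresholds occur: `D` is the best weight when the scan started, which fixes the strip and
bounds the triples of both sides, and `D'` is the best weight now. New triples are far, early, or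
among the pairs actually tried; the first two kinds weigh at least `D`. -/
theorem triplesGE_insert (h : StripState x y D xm M S m) (hs : Sides x y D xm L R)
    (hM : M ⊆ L ∪ R) {q : ℕ} {D' : ℝ} (hq : q ∈ L ∪ R) (hy : ∀ i ∈ M, y i ≤ y q) (hD : D' ≤ D)
    (hT : TriplesGE x y D' M)
    (hpairs : 2 * |x q - xm| < D → ∀ s t, m - 16 ≤ s → s < t → t < m →
      D' ≤ triWeight x y (S s) (S t) q) :
    TriplesGE x y D' (insert q M) := by
  refine hT.insert fun a ha b hb hab haq hbq => ?_
  have far := hs.le_triWeight_of_far (hM ha) (hM hb) hq hab haq hbq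
  by_cases hqn : 2 * |x q - xm| < D
  swap
  · exact hD.trans (far (.inr (.inr (not_lt.1 hqn))))
  by_cases han : 2 * |x a - xm| < D
  swap
  · exact hD.trans (far (.inl (not_lt.1 han)))
  by_cases hbn : 2 * |x b - xm| < D
  swap
  · exact hD.trans (far (.inr (.inl (not_lt.1 hbn))))
  obtain ⟨s, hsm, rfl⟩ := h.full a ha han
  obtain ⟨t, htm, rfl⟩ := h.full b hb hbn
  have key : ∀ s t, s < t → t < m → D' ≤ triWeight x y (S s) (S t) q := fun s t hst ht => by
    by_cases hearly : s + 16 < m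
    · exact hD.trans (h.le_triWeight_of_early hs hM hy hearly)
    · exact hpairs hqn s t (by omega) hst ht
  rcases lt_trichotomy s t with hlt | rfl | hlt
  · exact key s t hlt htm
  · exact absurd rfl hab
  · rw [triWeight_swap]; exact key t s hlt hsm

end StripState

/-! ### The strip scan as a program -/

namespace RealRAM

/-- Adds the absolute value of `e` to real variable `1`. -/
def addAbs (e : RExp) : Program :=
  .ite (.realLt e (.const 0)) (.setR 1 (.minus (.var 1) e)) (.setR 1 (.plus (.var 1) e))

/-- The difference of the coordinates in real array `a` of the points whose indices are in
natural variables `i` and `j`. -/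
def coordDiff (a i j : ℕ) : RExp := .minus (.cell a (.var i)) (.cell a (.var j))

/-- Puts the weight of the triple with indices in natural variables `18`, `19`, `17` into real
variable `1`. -/
def score : Program :=
  .seq (.setR 1 (.const 0)) (.seq (addAbs (coordDiff 0 18 19)) (.seq (addAbs (coordDiff 1 18 19))
    (.seq (addAbs (coordDiff 0 18 17)) (.seq (addAbs (coordDiff 1 18 17))
      (.seq (addAbs (coordDiff 0 19 17)) (addAbs (coordDiff 1 19 17)))))))

/-- Makes the triple with indices in natural variables `18`, `19`, `17` the best one so far. -/
def record : Program :=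
  .seq (.setR 0 (.var 1)) (.seq (.setN 14 (.var 18)) (.seq (.setN 15 (.var 19))
    (.setN 16 (.var 17))))

/-- Compares with the best triple so far the triple of the strip entries at positions `12` and
`13` (natural variables) and the point with index in natural variable `17`. -/
def tryTriple : Program :=
  .seq (.setN 18 (.cell 3 (.var 12))) (.seq (.setN 19 (.cell 3 (.var 13)))
    (.seq score (.ite (.realLt (.var 1) (.var 0)) record .skip)))

/-- Natural variables `14`, `15`, `16` hold the distinct indices of a triple, and real variable
`0` holds its weight. -/
structure Best (n : ℕ) (σ : Memory) : Prop where
  fst_lt : σ.nvar 14 < n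
  snd_lt : σ.nvar 15 < n
  trd_lt : σ.nvar 16 < n
  fst_ne_snd : σ.nvar 14 ≠ σ.nvar 15
  fst_ne_trd : σ.nvar 14 ≠ σ.nvar 16
  snd_ne_trd : σ.nvar 15 ≠ σ.nvar 16
  weight : σ.rvar 0 = triWeight (σ.rarr 0) (σ.rarr 1) (σ.nvar 14) (σ.nvar 15) (σ.nvar 16)

theorem Best.congr {n : ℕ} {σ τ : Memory} (h : Best n σ)
    (hn : ∀ i, 14 ≤ i → i ≤ 16 → τ.nvar i = σ.nvar i) (hr : τ.rvar 0 = σ.rvar 0)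
    (ha : τ.rarr = σ.rarr) : Best n τ := by
  have h1 := hn 14 (by norm_num) (by norm_num)
  have h2 := hn 15 (by norm_num) (by norm_num)
  have h3 := hn 16 (by norm_num) (by norm_num)
  obtain ⟨a, b, c, d, e, f, g⟩ := h
  constructor <;> simpa only [h1, h2, h3, hr, ha]

theorem Memory.setR_setR (σ : Memory) (i : ℕ) (r s : ℝ) : (σ.setR i r).setR i s = σ.setR i s := by
  simp [Memory.setR]

theorem addAbs_exec (e : RExp) (σ : Memory) :
    (addAbs e).exec σ = σ.setR 1 (σ.rvar 1 + |e.val σ|) := by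
  simp only [addAbs, Program.exec, Test.Holds, RExp.val, Rat.cast_zero]
  split_ifs with h
  · rw [abs_of_neg h, sub_eq_add_neg]
  · rw [abs_of_nonneg (not_lt.1 h)]

theorem score_exec (σ : Memory) : score.exec σ = σ.setR 1
    (triWeight (σ.rarr 0) (σ.rarr 1) (σ.nvar 18) (σ.nvar 19) (σ.nvar 17)) := by
  simp only [score, Program.exec, addAbs_exec, coordDiff, RExp.val, NExp.val, Memory.setR_setR,
    Memory.setR_rvar, Memory.setR_nvar, Memory.setR_rarr, if_true, triWeight]
  congr 1
  push_cast
  ring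

theorem tryTriple_halts {n : ℕ} {σ : Memory} {a b q : ℕ} (ha : σ.narr 3 (σ.nvar 12) = a)
    (hb : σ.narr 3 (σ.nvar 13) = b) (hq : σ.nvar 17 = q) (han : a < n) (hbn : b < n) (hqn : q < n)
    (hab : a ≠ b) (haq : a ≠ q) (hbq : b ≠ q) (hBest : Best n σ) :
    Halts tryTriple σ 200 fun τ =>
      τ.rvar 0 ≤ σ.rvar 0 ∧ τ.rvar 0 ≤ triWeight (σ.rarr 0) (σ.rarr 1) a b q ∧ Best n τ := by
  refine .exec rfl (by simp [tryTriple, score, record, addAbs, coordDiff, Program.time, Test.cost,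
    RExp.cost, NExp.cost]) ?_
  simp only [tryTriple, Program.exec, score_exec, NExp.val, Memory.setN_nvar, Memory.setN_narr,
    Memory.setN_rarr, Memory.setN_rvar, Memory.setR_rvar, Test.Holds, RExp.val, record]
  norm_num
  simp only [ha, hb, hq]
  split_ifs with h
  · refine ⟨by simpa using h.le, by simp, ?_⟩
    constructor <;> simp <;> assumption
  · refine ⟨by simp, by simpa using h, hBest.congr ?_ (by simp) rfl⟩
    intro i h1 h2
    simp only [Memory.setR_nvar, Memory.setN_nvar]
    rw [if_neg (by omega), if_neg (by omega)]

/-- Tries the triples with a fixed first strip entry. -/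
def pairLoopB : Program :=
  .loop (.natLt (.var 13) (.var 10)) (.seq tryTriple (.setN 13 (.plus (.var 13) (.const 1))))

/-- Tries the triples of two strip entries and the current point. -/
def pairLoopA : Program :=
  .loop (.natLt (.var 12) (.var 10)) (.seq (.setN 13 (.plus (.var 12) (.const 1)))
    (.seq pairLoopB (.setN 12 (.plus (.var 12) (.const 1)))))

theorem pairLoopB_halts {n m q s : ℕ} {S : ℕ → ℕ} {σ₀ : Memory} (hS : σ₀.narr 3 = S)
    (hm : σ₀.nvar 10 = m) (hq : σ₀.nvar 17 = q) (hs : σ₀.nvar 12 = s) (hs' : σ₀.nvar 13 = s + 1)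
    (hsm : s < m) (hqn : q < n) (hSn : ∀ t < m, S t < n) (hSq : ∀ t < m, S t ≠ q)
    (hinj : ∀ t t', t < t' → t' < m → S t ≠ S t') (hBest : Best n σ₀) :
    Halts pairLoopB σ₀ (220 * (m - (s + 1)) + 4) fun τ => τ.rvar 0 ≤ σ₀.rvar 0 ∧ Best n τ ∧
      ∀ t, s < t → t < m → τ.rvar 0 ≤ triWeight (σ₀.rarr 0) (σ₀.rarr 1) (S s) (S t) q := by
  refine (Halts.loop (K := 220) (r₀ := m - (s + 1)) (fun r σ => r = m - σ.nvar 13 ∧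
    s < σ.nvar 13 ∧ σ.rvar 0 ≤ σ₀.rvar 0 ∧ Best n σ ∧ ∀ t, s < t → t < σ.nvar 13 →
      σ.rvar 0 ≤ triWeight (σ₀.rarr 0) (σ₀.rarr 1) (S s) (S t) q) ?_ ?_).mono
    (by simp [Test.cost, NExp.cost]) ?_
  · exact ⟨by rw [hs'], by omega, le_rfl, hBest, fun t h1 h2 => by omega⟩
  · rintro r σ ⟨rfl, h13, hD, hB, hdone⟩ hF hb
    have e10 : σ.nvar 10 = m := (hF.nvar 10 (by decide)).trans hm
    have e17 : σ.nvar 17 = q := (hF.nvar 17 (by decide)).trans hq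
    have e12 : σ.nvar 12 = s := (hF.nvar 12 (by decide)).trans hs
    have eS : σ.narr 3 = S := (hF.narr 3 (by decide)).trans hS
    have eR : σ.rarr = σ₀.rarr := funext fun a =>
      hF.rarr a (by simp [Program.rarrs, tryTriple, score, addAbs, record])
    simp only [Test.Holds, NExp.val, e10] at hb
    refine ⟨m - (σ.nvar 13 + 1), 200 + 4, ?_, ?_⟩
    · simp only [Test.cost, NExp.cost]; omega
    · refine Halts.seq (tryTriple_halts (a := S s) (b := S (σ.nvar 13)) (q := q) (by rw [eS, e12])
        (by rw [eS]) e17 (hSn _ hsm) (hSn _ hb) hqn (hinj _ _ h13 hb) (hSq _ hsm) (hSq _ hb) hB)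
        ?_ le_rfl
      rintro ρ hFρ ⟨hρ1, hρ2, hρB⟩
      refine .exec rfl (by simp [Program.time, NExp.cost]) ?_
      have r13 : ρ.nvar 13 = σ.nvar 13 := hFρ.nvar 13 (by decide)
      simp only [Program.exec, NExp.val, Memory.setN_nvar, Memory.setN_rvar, if_true, r13]
      refine ⟨trivial, by omega, hρ1.trans hD, hρB.congr ?_ rfl rfl, fun t ht ht' => ?_⟩
      · intro i h1 h2
        rw [Memory.setN_nvar, if_neg (by omega)]
      · rcases Nat.lt_succ_iff_lt_or_eq.1 ht' with h | rfl
        · exact hρ1.trans (hdone t ht h)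
        · rw [eR] at hρ2; exact hρ2
  · rintro τ hF ⟨⟨r, -, h13, hD, hB, hdone⟩, hb⟩
    have e10 : τ.nvar 10 = m := (hF.nvar 10 (by decide)).trans hm
    simp only [Test.Holds, NExp.val, e10] at hb
    exact ⟨hD, hB, fun t h1 h2 => hdone t h1 (by omega)⟩

theorem pairLoopA_halts {n m q : ℕ} {S : ℕ → ℕ} {σ₀ : Memory} (hS : σ₀.narr 3 = S)
    (hm : σ₀.nvar 10 = m) (hq : σ₀.nvar 17 = q) (hs : σ₀.nvar 12 = m - 16)
    (hqn : q < n) (hSn : ∀ t < m, S t < n) (hSq : ∀ t < m, S t ≠ q)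
    (hinj : ∀ t t', t < t' → t' < m → S t ≠ S t') (hBest : Best n σ₀) :
    Halts pairLoopA σ₀ 60000 fun τ => τ.rvar 0 ≤ σ₀.rvar 0 ∧ Best n τ ∧
      ∀ s t, m - 16 ≤ s → s < t → t < m →
        τ.rvar 0 ≤ triWeight (σ₀.rarr 0) (σ₀.rarr 1) (S s) (S t) q := by
  -- There are at most 16 first entries, each with at most 15 partners at 220 steps; 3600 also
  -- covers the overhead.
  refine (Halts.loop (K := 3600) (r₀ := m - (m - 16)) (fun r σ => r = m - σ.nvar 12 ∧
    m - 16 ≤ σ.nvar 12 ∧ σ.rvar 0 ≤ σ₀.rvar 0 ∧ Best n σ ∧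
    ∀ s t, m - 16 ≤ s → s < σ.nvar 12 → s < t → t < m →
      σ.rvar 0 ≤ triWeight (σ₀.rarr 0) (σ₀.rarr 1) (S s) (S t) q) ?_ ?_).mono
    (by simp only [Test.cost, NExp.cost]; omega) ?_
  · exact ⟨by rw [hs], by omega, le_rfl, hBest, fun s t h1 h2 => by omega⟩
  · rintro r σ ⟨rfl, h12, hD, hB, hdone⟩ hF hb
    have e10 : σ.nvar 10 = m := (hF.nvar 10 (by decide)).trans hm
    have e17 : σ.nvar 17 = q := (hF.nvar 17 (by decide)).trans hq
    have eS : σ.narr 3 = S := (hF.narr 3 (by decide)).trans hS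
    have eR : σ.rarr = σ₀.rarr := funext fun a =>
      hF.rarr a (by simp [Program.rarrs, pairLoopB, tryTriple, score, addAbs, record])
    simp only [Test.Holds, NExp.val, e10] at hb
    refine ⟨m - (σ.nvar 12 + 1), 4 + ((220 * (m - (σ.nvar 12 + 1)) + 4) + 4), ?_, ?_⟩
    · simp only [Test.cost, NExp.cost]; omega
    · refine Halts.seq (B₁ := 4) (.exec (Q := fun ρ => ρ = σ.setN 13 (σ.nvar 12 + 1)) rfl
        le_rfl rfl) ?_ le_rfl
      rintro _ - rfl
      refine Halts.seq (pairLoopB_halts (n := n) (m := m) (q := q) (s := σ.nvar 12) (S := S)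
        (by simp [eS]) (by simp [e10]) (by simp [e17]) (by simp) (by simp) hb hqn hSn hSq hinj
        (hB.congr (fun i h1 h2 => ?_) rfl rfl)) ?_ le_rfl
      · rw [Memory.setN_nvar, if_neg (by omega)]
      rintro ρ hFρ ⟨hρ1, hρB, hρ2⟩
      refine .exec rfl (by simp [Program.time, NExp.cost]) ?_
      have r12 : ρ.nvar 12 = σ.nvar 12 := (hFρ.nvar 12 (by decide)).trans (by simp)
      simp only [Program.exec, NExp.val, Memory.setN_nvar, Memory.setN_rvar, Memory.setN_rarr,
        if_true, r12, eR] at hρ1 hρ2 ⊢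
      refine ⟨trivial, by omega, hρ1.trans hD, hρB.congr ?_ rfl rfl, fun s t h h' ht ht' => ?_⟩
      · intro i h1 h2
        rw [Memory.setN_nvar, if_neg (by omega)]
      · rcases Nat.lt_succ_iff_lt_or_eq.1 h' with h' | rfl
        · exact hρ1.trans (hdone s t h h' ht ht')
        · exact hρ2 t ht ht'
  · rintro τ hF ⟨⟨r, -, h12, hD, hB, hdone⟩, hb⟩
    have e10 : τ.nvar 10 = m := (hF.nvar 10 (by decide)).trans hm
    simp only [Test.Holds, NExp.val, e10] at hb
    exact ⟨hD, hB, fun s t h1 h2 h3 => hdone s t h1 (by omega) h2 h3⟩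

/-- The `x`-coordinate of the last point of the left block in the `x`-order. -/
def midCoord : RExp := .cell 0 (.cell 0 (.minus (.var 5) (.const 1)))

/-- Whether the current point is in the strip around the vertical line at `midCoord`. -/
def nearTest : Test :=
  .conj
    (.realLt (.times (.const 2) (.minus (.cell 0 (.var 17)) midCoord)) (.var 2))
    (.realLt (.times (.const 2) (.minus midCoord (.cell 0 (.var 17)))) (.var 2))

/-- Tries the triples of the current point and two of the last 16 strip entries, and appends
the current point to the strip. -/
def pushStrip : Program :=
  .seq (.setN 12 (.minus (.var 10) (.const 16))) (.seq pairLoopA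
    (.seq (.storeN 3 (.var 10) (.var 17)) (.setN 10 (.plus (.var 10) (.const 1)))))

/-- Processes the point at position `11` (natural variable) of the `y`-order. -/
def stripBody : Program :=
  .seq (.setN 17 (.cell 2 (.var 11))) (.seq (.ite nearTest pushStrip .skip)
    (.setN 11 (.plus (.var 11) (.const 1))))

/-- Scans the strip of the block `[lo, hi)` in `y`-order. -/
def strip : Program :=
  -- The width is frozen, so that `StripState` speaks of one fixed strip while the best weight in
  -- real variable 0 drops during the scan.
  .seq (.setR 2 (.var 0)) (.seq (.setN 10 (.const 0)) (.seq (.setN 11 (.var 4))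
    (.loop (.natLt (.var 11) (.var 6)) stripBody)))

theorem nearTest_holds {σ : Memory} : nearTest.Holds σ ↔
    2 * |σ.rarr 0 (σ.nvar 17) - σ.rarr 0 (σ.narr 0 (σ.nvar 5 - 1))| < σ.rvar 2 := by
  simp only [nearTest, midCoord, Test.Holds, RExp.val, NExp.val, Rat.cast_ofNat]
  rw [← lt_div_iff₀' (by norm_num), ← lt_div_iff₀' (by norm_num), ← lt_div_iff₀' (by norm_num),
    abs_lt]
  constructor
  · rintro ⟨h1, h2⟩
    exact ⟨by linarith, h1⟩
  · rintro ⟨h1, h2⟩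
    exact ⟨h2, by linarith⟩

theorem pushStrip_halts {n m q : ℕ} {x y : ℕ → ℝ} {D xm : ℝ} {M : Set ℕ} {σ₀ : Memory}
    (hx : σ₀.rarr 0 = x) (hy : σ₀.rarr 1 = y) (hm : σ₀.nvar 10 = m) (hq : σ₀.nvar 17 = q)
    (hqn : q < n) (hMn : ∀ i ∈ M, i < n) (hqM : q ∉ M) (hyM : ∀ i ∈ M, y i ≤ y q)
    (hnear : 2 * |x q - xm| < D) (hBest : Best n σ₀)
    (hS : StripState x y D xm M (σ₀.narr 3) m) :
    Halts pushStrip σ₀ 60030 fun τ => τ.rvar 0 ≤ σ₀.rvar 0 ∧ Best n τ ∧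
      StripState x y D xm (insert q M) (τ.narr 3) (τ.nvar 10) ∧
      ∀ s t, m - 16 ≤ s → s < t → t < m →
        τ.rvar 0 ≤ triWeight x y (σ₀.narr 3 s) (σ₀.narr 3 t) q := by
  refine Halts.seq (B₁ := 4) (.exec (Q := fun ρ => ρ = σ₀.setN 12 (m - 16)) rfl
    le_rfl (by simp [Program.exec, NExp.val, hm])) (B₂ := 60000 + (3 + 4)) ?_ (by norm_num)
  rintro _ - rfl
  refine Halts.seq (pairLoopA_halts (n := n) (m := m) (q := q) (S := σ₀.narr 3)
    (by simp) (by simp [hm]) (by simp [hq]) (by simp) hqn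
    (fun t ht => hMn _ (hS.mem t ht)) (fun t ht h => hqM (h ▸ hS.mem t ht)) hS.inj
    (hBest.congr (fun i h1 h2 => ?_) rfl rfl)) ?_ le_rfl
  · rw [Memory.setN_nvar, if_neg (by omega)]
  rintro ρ hFρ ⟨hρ1, hρB, hρ2⟩
  refine .exec rfl (by simp [Program.time, NExp.cost]) ?_
  have r10 : ρ.nvar 10 = m := (hFρ.nvar 10 (by decide)).trans (by simp [hm])
  have r17 : ρ.nvar 17 = q := (hFρ.nvar 17 (by decide)).trans (by simp [hq])
  have r3 : ρ.narr 3 = σ₀.narr 3 := (hFρ.narr 3 (by decide)).trans (by simp)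
  simp only [Program.exec, NExp.val, Memory.setN_nvar, Memory.setN_rvar, Memory.setN_rarr,
    Memory.setN_narr, Memory.storeN_nvar, Memory.storeN_rvar, Memory.storeN_narr,
    if_true, r10, r17, r3, hx, hy] at hρ1 hρ2 ⊢
  refine ⟨hρ1, hρB.congr ?_ rfl rfl, hS.push hnear hqM hyM, hρ2⟩
  intro i h1 h2
  rw [Memory.setN_nvar, if_neg (by omega), Memory.storeN_nvar]

theorem image_Ico_succ {Y : ℕ → ℕ} {lo pos : ℕ} (h : lo ≤ pos) :
    Y '' Set.Ico lo (pos + 1) = insert (Y pos) (Y '' Set.Ico lo pos) := by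
  rw [← Set.image_insert_eq]
  congr 1
  ext l
  simp only [Set.mem_Ico, Set.mem_insert_iff]
  omega

/-- The loop keeps two facts about the processed points: their triples weigh at least the current
best, and array 3 lists those in the frozen strip. `StripState.triplesGE_insert` carries the first
fact over one more point. -/
theorem strip_halts {n lo mid hi : ℕ} {x y : ℕ → ℝ} {X Y : ℕ → ℕ} {L R : Set ℕ} {σ₀ : Memory}
    (h4 : σ₀.nvar 4 = lo) (h5 : σ₀.nvar 5 = mid) (h6 : σ₀.nvar 6 = hi) (hlh : lo < hi)
    (hx : σ₀.rarr 0 = x) (hy : σ₀.rarr 1 = y) (hX : σ₀.narr 0 = X) (hY : σ₀.narr 2 = Y)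
    (hYn : ∀ l, lo ≤ l → l < hi → Y l < n) (hYs : SortedOn (fun l => y (Y l)) lo hi)
    (hYinj : Set.InjOn Y (Set.Ico lo hi)) (hYM : Y '' Set.Ico lo hi ⊆ L ∪ R)
    (hsides : Sides x y (σ₀.rvar 0) (x (X (mid - 1))) L R) (hBest : Best n σ₀) :
    Halts strip σ₀ (61000 * (hi - lo)) fun τ => τ.rvar 0 ≤ σ₀.rvar 0 ∧ Best n τ ∧
      TriplesGE x y (τ.rvar 0) (Y '' Set.Ico lo hi) := by
  refine Halts.seq (B₁ := 2) (.exec (Q := fun ρ => ρ = σ₀.setR 2 (σ₀.rvar 0)) rfl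
    le_rfl rfl) (B₂ := 2 + (2 + (60200 * (hi - lo) + 4))) ?_ (by omega)
  rintro _ - rfl
  refine Halts.seq (B₁ := 2) (.exec (Q := fun ρ => ρ = (σ₀.setR 2 (σ₀.rvar 0)).setN 10 0) rfl
    le_rfl rfl) ?_ le_rfl
  rintro _ - rfl
  refine Halts.seq (B₁ := 2) (.exec (Q := fun ρ => ρ = ((σ₀.setR 2 (σ₀.rvar 0)).setN 10 0).setN 11
    lo) rfl le_rfl (by simp [Program.exec, NExp.val, h4])) ?_ le_rfl
  rintro _ - rfl
  set σ₁ := ((σ₀.setR 2 (σ₀.rvar 0)).setN 10 0).setN 11 lo with hσ₁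
  have k5 : σ₁.nvar 5 = mid := by simp [hσ₁, h5]
  have k6 : σ₁.nvar 6 = hi := by simp [hσ₁, h6]
  have k10 : σ₁.nvar 10 = 0 := by simp [hσ₁]
  have k11 : σ₁.nvar 11 = lo := by simp [hσ₁]
  have kD : σ₁.rvar 2 = σ₀.rvar 0 := by simp [hσ₁]
  have kD0 : σ₁.rvar 0 = σ₀.rvar 0 := by simp [hσ₁]
  have kB : Best n σ₁ := by
    refine hBest.congr (fun i h1 h2 => ?_) kD0 rfl
    rw [hσ₁, Memory.setN_nvar, if_neg (by omega), Memory.setN_nvar, if_neg (by omega),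
      Memory.setR_nvar]
  have kR : σ₁.rarr = σ₀.rarr := rfl
  have kA : σ₁.narr = σ₀.narr := rfl
  clear_value σ₁
  refine (Halts.loop (K := 60200) (r₀ := hi - lo) (fun r σ => r = hi - σ.nvar 11 ∧
    lo ≤ σ.nvar 11 ∧ σ.nvar 11 ≤ hi ∧ σ.rvar 0 ≤ σ₀.rvar 0 ∧ Best n σ ∧
    TriplesGE x y (σ.rvar 0) (Y '' Set.Ico lo (σ.nvar 11)) ∧
    StripState x y (σ₀.rvar 0) (x (X (mid - 1))) (Y '' Set.Ico lo (σ.nvar 11)) (σ.narr 3) (σ.nvar 10))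
    ?_ ?_).mono (by simp [Test.cost, NExp.cost]) ?_
  · rw [k11, k10, kD0, Set.Ico_self, Set.image_empty]
    exact ⟨rfl, le_rfl, hlh.le, le_rfl, kB, fun i hi => absurd hi (Set.notMem_empty i), .empty⟩
  · rintro r σ ⟨rfl, hle, hle', hD, hB, hT, hS⟩ hF hb
    have e5 : σ.nvar 5 = mid := (hF.nvar 5 (by decide)).trans k5
    have e6 : σ.nvar 6 = hi := (hF.nvar 6 (by decide)).trans k6
    have eX : σ.narr 0 = X := (hF.narr 0 (by decide)).trans (by rw [kA, hX])
    have eY : σ.narr 2 = Y := (hF.narr 2 (by decide)).trans (by rw [kA, hY])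
    have eR : σ.rarr = σ₁.rarr := funext fun a => hF.rarr a (by
      simp [Program.rarrs, stripBody, pushStrip, pairLoopA, pairLoopB, tryTriple, score, addAbs,
        record])
    have ex : σ.rarr 0 = x := by rw [eR, kR, hx]
    have ey : σ.rarr 1 = y := by rw [eR, kR, hy]
    have e2 : σ.rvar 2 = σ₀.rvar 0 := (hF.rvar 2 (by decide)).trans kD
    simp only [Test.Holds, NExp.val, e6] at hb
    set pos := σ.nvar 11 with hpos
    have hsub : Y '' Set.Ico lo pos ⊆ L ∪ R := fun i ⟨l, hl, he⟩ =>
      hYM ⟨l, ⟨hl.1, hl.2.trans hb⟩, he⟩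
    have hqLR : Y pos ∈ L ∪ R := hYM ⟨pos, ⟨hle, hb⟩, rfl⟩
    have hyM : ∀ i ∈ Y '' Set.Ico lo pos, y i ≤ y (Y pos) := by
      rintro _ ⟨l, hl, rfl⟩
      exact hYs l pos hl.1 hl.2.le hb
    have hqM : Y pos ∉ Y '' Set.Ico lo pos := by
      rintro ⟨l, hl, he⟩
      have := hYinj ⟨hl.1, hl.2.trans hb⟩ ⟨hle, hb⟩ he
      exact absurd this hl.2.ne
    refine ⟨hi - (pos + 1), 3 + ((100 + 60030) + 4), ?_, ?_⟩
    · simp only [Test.cost, NExp.cost]; omega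
    · refine Halts.seq (B₁ := 3) (.exec (Q := fun ρ => ρ = σ.setN 17 (Y pos)) rfl le_rfl
        (by simp [Program.exec, NExp.val, eY, ← hpos])) ?_ le_rfl
      rintro _ - rfl
      have hB' : Best n (σ.setN 17 (Y pos)) := hB.congr (fun i h1 h2 => by
        rw [Memory.setN_nvar, if_neg (by omega)]) rfl rfl
      have hnear : nearTest.Holds (σ.setN 17 (Y pos)) ↔
          2 * |x (Y pos) - x (X (mid - 1))| < σ₀.rvar 0 := by
        rw [nearTest_holds]
        simp [ex, eX, e5, e2]
      have hbranch : Halts (.ite nearTest pushStrip .skip) (σ.setN 17 (Y pos)) (100 + 60030)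
          fun τ => τ.rvar 0 ≤ σ.rvar 0 ∧ Best n τ ∧
            TriplesGE x y (τ.rvar 0) (insert (Y pos) (Y '' Set.Ico lo pos)) ∧
            StripState x y (σ₀.rvar 0) (x (X (mid - 1))) (insert (Y pos) (Y '' Set.Ico lo pos))
              (τ.narr 3) (τ.nvar 10) := by
        refine (Halts.ite (B := 60030) (fun h => ?_) (fun h => ?_)).mono (by
          simp [nearTest, midCoord, Test.cost, RExp.cost, NExp.cost]) fun _ _ h => h
        · rw [hnear] at h
          refine (pushStrip_halts (n := n) (by simp [ex]) (by simp [ey]) (m := σ.nvar 10) (by simp)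
            (q := Y pos) (by simp) (hYn _ hle hb) ?_ hqM hyM h hB' hS).mono le_rfl ?_
          · rintro _ ⟨l, hl, rfl⟩
            exact hYn l hl.1 (hl.2.trans hb)
          · rintro τ - ⟨h1, h2, h3, h4⟩
            exact ⟨h1, h2, hS.triplesGE_insert hsides hsub hqLR hyM (h1.trans hD)
              (hT.mono h1 subset_rfl) fun _ => h4, h3⟩
        · rw [hnear] at h
          refine .exec rfl (by simp [Program.time]) ⟨le_rfl, hB', ?_, hS.skip (not_lt.1 h)⟩
          exact hS.triplesGE_insert hsides hsub hqLR hyM hD hT fun h' => absurd h' h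
      refine Halts.seq hbranch ?_ le_rfl
      rintro ρ hFρ ⟨h1, h2, h3, h4⟩
      have r11 : ρ.nvar 11 = pos := (hFρ.nvar 11 (by decide)).trans (by simp [hpos])
      refine .exec rfl (by simp [Program.time, NExp.cost]) ?_
      simp only [Program.exec, NExp.val, r11, Memory.setN_nvar, Memory.setN_rvar, Memory.setN_narr,
        if_true, image_Ico_succ hle]
      refine ⟨trivial, by omega, by omega, h1.trans hD, h2.congr (fun i h1 h2 => ?_) rfl rfl, h3, h4⟩
      rw [Memory.setN_nvar, if_neg (by omega)]
  · rintro τ hF ⟨⟨r, -, hle, hle', hD, hB, hT, -⟩, hb⟩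
    have e6 : τ.nvar 6 = hi := (hF.nvar 6 (by decide)).trans k6
    simp only [Test.Holds, NExp.val, e6] at hb
    have e11 : τ.nvar 11 = hi := by omega
    rw [e11] at hT
    exact ⟨hD, hB, hT⟩

end RealRAM

/-! ### Permutations and rearrangements -/

/-- `α` permutes the numbers below `n`. -/
structure PermBelow (n : ℕ) (α : ℕ → ℕ) : Prop where
  lt : ∀ l < n, α l < n
  inj : Set.InjOn α (Set.Iio n)

theorem PermBelow.image_Ico {n : ℕ} {α : ℕ → ℕ} (h : PermBelow n α) :
    α '' Set.Ico 0 n = Set.Iio n := by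
  have h1 : (Finset.range n).image α = Finset.range n := by
    refine Finset.eq_of_subset_of_card_le (Finset.image_subset_iff.2 fun l hl => ?_) ?_
    · simpa using h.lt l (by simpa using hl)
    · rw [Finset.card_image_of_injOn]
      simpa [Finset.coe_range] using h.inj
  have h2 := congrArg (fun s : Finset ℕ => (s : Set ℕ)) h1
  simp only [Finset.coe_image, Finset.coe_range] at h2
  rwa [← Nat.bot_eq_zero, Set.Ico_bot]

/-- Counting: `β` takes all the `hi - lo` distinct values of `α` on only that many positions, so it
takes no others and repeats none. -/
theorem rearrange {α β : ℕ → ℕ} {lo hi : ℕ} (hα : Set.InjOn α (Set.Ico lo hi))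
    (h : ∀ l, lo ≤ l → l < hi → ∃ l', lo ≤ l' ∧ l' < hi ∧ β l' = α l) :
    β '' Set.Ico lo hi = α '' Set.Ico lo hi ∧ Set.InjOn β (Set.Ico lo hi) := by
  have hsub : (Finset.Ico lo hi).image α ⊆ (Finset.Ico lo hi).image β := by
    intro v hv
    obtain ⟨l, hl, rfl⟩ := Finset.mem_image.1 hv
    rw [Finset.mem_Ico] at hl
    obtain ⟨l', h1, h2, h3⟩ := h l hl.1 hl.2
    exact Finset.mem_image.2 ⟨l', Finset.mem_Ico.2 ⟨h1, h2⟩, h3⟩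
  have hcα : ((Finset.Ico lo hi).image α).card = (Finset.Ico lo hi).card :=
    Finset.card_image_of_injOn (by simpa using hα)
  have hcβ := Finset.card_image_le (s := Finset.Ico lo hi) (f := β)
  have heq := Finset.eq_of_subset_of_card_le hsub (by omega)
  constructor
  · have := congrArg (fun s : Finset ℕ => (s : Set ℕ)) heq.symm
    simpa using this
  · rw [heq] at hcα
    simpa using Finset.card_image_iff.1 hcα

theorem PermBelow.rearrange {n lo hi : ℕ} {α β : ℕ → ℕ} (hα : PermBelow n α) (hn : hi ≤ n)
    (h : ∀ l, lo ≤ l → l < hi → ∃ l', lo ≤ l' ∧ l' < hi ∧ β l' = α l)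
    (hout : ∀ l, l < lo ∨ hi ≤ l → β l = α l) :
    PermBelow n β ∧ β '' Set.Ico lo hi = α '' Set.Ico lo hi := by
  obtain ⟨him, hinj⟩ := _root_.rearrange (hα.inj.mono fun l hl => hl.2.trans_le hn) h
  have hin : ∀ l, lo ≤ l → l < hi → ∃ l', lo ≤ l' ∧ l' < hi ∧ α l' = β l := fun l h1 h2 => by
    obtain ⟨l', h, h'⟩ : β l ∈ α '' Set.Ico lo hi := him ▸ ⟨l, ⟨h1, h2⟩, rfl⟩
    exact ⟨l', h.1, h.2, h'⟩
  -- A value inside the block comes from a position of `α` inside it, so by injectivity of `α` it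
  -- cannot also stand outside.
  have hne : ∀ a b, a < n → b < n → lo ≤ a ∧ a < hi → b < lo ∨ hi ≤ b → β a ≠ β b := by
    intro a b ha hb hain hbout he
    obtain ⟨l, h1, h2, h3⟩ := hin a hain.1 hain.2
    rw [← h3, hout b hbout] at he
    have := hα.inj (show l < n by omega) hb he
    omega
  refine ⟨⟨fun l hl => ?_, fun a ha b hb he => ?_⟩, him⟩
  · by_cases hl' : lo ≤ l ∧ l < hi
    · obtain ⟨l', h1, h2, h3⟩ := hin l hl'.1 hl'.2
      rw [← h3]
      exact hα.lt l' (by omega)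
    · rw [hout l (by omega)]
      exact hα.lt l hl
  · simp only [Set.mem_Iio] at ha hb
    by_cases ha' : lo ≤ a ∧ a < hi <;> by_cases hb' : lo ≤ b ∧ b < hi
    · exact hinj ha' hb' he
    · exact absurd he (hne a b ha hb ha' (by omega))
    · exact absurd he.symm (hne b a hb ha hb' (by omega))
    · rw [hout a (by omega), hout b (by omega)] at he
      exact hα.inj ha hb he

/-! ### The complete algorithm -/

namespace RealRAM

theorem sortedOn_self_succ (f : ℕ → ℝ) (a : ℕ) : SortedOn f a (a + 1) := by
  intro b c h1 h2 h3
  rw [show b = c by omega]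

theorem SortedOn.congr {f g : ℕ → ℝ} {a b : ℕ} (h : SortedOn f a b)
    (hfg : ∀ l, a ≤ l → l < b → g l = f l) : SortedOn g a b := by
  intro l l' h1 h2 h3
  rw [hfg l h1 (by omega), hfg l' (by omega) h3]
  exact h l l' h1 h2 h3

/-- Sets the first `n` entries of array `A` to the values of `e`, where natural variable `9`
counts. -/
def fill (A : ℕ) (e : NExp) : Program :=
  .seq (.setN 9 (.const 0)) (.loop (.natLt (.var 9) (.var 0))
    (.seq (.storeN A (.var 9) e) (.setN 9 (.plus (.var 9) (.const 1)))))

/-- In `hg` the memory ranges over the frame of the program, which lets `e` read an array that the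
loop does not write. -/
theorem fill_halts {A n : ℕ} {e : NExp} {g : ℕ → ℕ} {σ₀ : Memory} (h0 : σ₀.nvar 0 = n)
    (he : e.cost ≤ 2) (hg : ∀ σ, (fill A e).Frame σ₀ σ → e.val σ = g (σ.nvar 9)) :
    Halts (fill A e) σ₀ (20 * n + 6) fun τ => ∀ l < n, τ.narr A l = g l := by
  refine Halts.seq (B₁ := 2) (.exec (Q := fun ρ => ρ = σ₀.setN 9 0) rfl le_rfl rfl)
    (B₂ := 20 * n + 4) ?_ (by omega)
  rintro _ hF₀ rfl
  refine (Halts.loop (K := 20) (r₀ := n) (fun r σ => r = n - σ.nvar 9 ∧ σ.nvar 9 ≤ n ∧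
    ∀ l < σ.nvar 9, σ.narr A l = g l) (by simp) ?_).mono (by simp [Test.cost, NExp.cost]) ?_
  · rintro r σ ⟨rfl, h9, hl⟩ hF hb
    have e0 : σ.nvar 0 = n := (hF.nvar 0 (by simp [Program.nvars])).trans (by simp [h0])
    have hσ : (fill A e).Frame σ₀ σ := (hF₀.mono (by simp [fill, Program.nvars])
      (by simp [Program.rvars]) (by simp [Program.narrs]) (by simp [Program.rarrs])).trans
      (hF.mono (by simp [fill, Program.nvars]) (by simp [Program.rvars])
      (by simp [fill, Program.narrs]) (by simp [Program.rarrs]))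
    simp only [Test.Holds, NExp.val, e0] at hb
    refine ⟨n - (σ.nvar 9 + 1), 8, ?_, ?_⟩
    · simp only [Test.cost, NExp.cost]; omega
    · refine .exec rfl (by simp only [Program.time, NExp.cost]; omega) ?_
      simp only [Program.exec, NExp.val, Memory.setN_nvar, Memory.setN_narr, Memory.storeN_nvar,
        Memory.storeN_narr, if_true, hg σ hσ]
      refine ⟨trivial, by omega, fun l h => ?_⟩
      rcases Nat.lt_succ_iff_lt_or_eq.1 h with h | rfl
      · rw [Function.update_of_ne h.ne, hl l h]
      · rw [Function.update_self]
  · rintro τ hF ⟨⟨r, -, h9, hl⟩, hb⟩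
    have e0 : τ.nvar 0 = n := (hF.nvar 0 (by simp [Program.nvars])).trans (by simp [h0])
    simp only [Test.Holds, NExp.val, e0] at hb
    exact fun l h => hl l (by omega)

theorem sortX_halts {n : ℕ} (hn : 0 < n) {σ₀ : Memory} (h0 : σ₀.nvar 0 = n)
    (hX : PermBelow n (σ₀.narr 0)) :
    Halts (bottomUp (merge 0 0)) σ₀ ((130 * n + 20) * Nat.clog 2 n + 6) fun τ =>
      τ.rarr = σ₀.rarr ∧ PermBelow n (τ.narr 0) ∧ τ.nvar 0 = n ∧
      SortedOn (fun l => σ₀.rarr 0 (τ.narr 0 l)) 0 n := by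
  refine (bottomUp_halts (n := n) (K := 100)
    (I := fun σ => σ.rarr = σ₀.rarr ∧ PermBelow n (σ.narr 0))
    (seg := fun σ a b => SortedOn (fun l => σ₀.rarr 0 (σ.narr 0 l)) a b)
    (by decide) (fun σ i m _ _ h => h) (fun σ i m a b _ _ h => h)
    (fun σ a b c h1 h2 h3 => by omega) ?_ hn h0 ⟨rfl, hX⟩
    (fun a _ => sortedOn_self_succ _ a)).mono le_rfl ?_
  · rintro σ lo mid hi ⟨hR, hP⟩ h0 h4 h5 h6 hlm hmh hhn h1 h2
    rw [← hR] at h1 h2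
    refine (merge_halts (by norm_num) h4 h5 h6 hlm hmh h1 h2).mono le_rfl ?_
    rintro τ hF ⟨k1, k2, k3⟩
    rw [hR] at k1
    refine ⟨⟨?_, (hP.rearrange hhn k2 k3).1⟩, k1, fun a b hab hs => hs.congr fun l h1 h2 => ?_⟩
    · rw [← hR]
      exact funext fun a => hF.rarr a (by simp [merge, mergeBody, copyLoop, Program.rarrs])
    · rw [k3 l (by omega)]
  · rintro τ - ⟨⟨h1, h2⟩, h3, h4⟩
    exact ⟨h1, h2, h3, h4⟩

/-- Joins two neighbouring blocks: merges them by `y`-coordinate and scans the strip. -/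
def joinBlocks : Program := .seq (merge 2 1) strip

/-- The block `[a, b)` of the `y`-order (array `2`) is sorted, lists the points of the block
`[a, b)` of the `x`-order `X`, and none of its triples beats the best one. -/
structure BlockDone (x y : ℕ → ℝ) (X : ℕ → ℕ) (σ : Memory) (a b : ℕ) : Prop where
  sorted : SortedOn (fun l => y (σ.narr 2 l)) a b
  image : σ.narr 2 '' Set.Ico a b = X '' Set.Ico a b
  triples : TriplesGE x y (σ.rvar 0) (X '' Set.Ico a b)

/-- A lower best weight only weakens the demand on the triples, so finished blocks survive joins
elsewhere. -/
theorem BlockDone.congr {x y : ℕ → ℝ} {X : ℕ → ℕ} {σ τ : Memory} {a b : ℕ}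
    (h : BlockDone x y X σ a b) (hY : ∀ l, a ≤ l → l < b → τ.narr 2 l = σ.narr 2 l)
    (hD : τ.rvar 0 ≤ σ.rvar 0) : BlockDone x y X τ a b := by
  refine ⟨h.sorted.congr fun l h1 h2 => by rw [hY l h1 h2], ?_, h.triples.mono hD subset_rfl⟩
  rw [← h.image]
  exact Set.image_congr fun l hl => hY l hl.1 hl.2

/-- Since `X` is sorted by `x`, the vertical line through its entry at `mid - 1` separates the two
blocks, ties included. Merging by `y` keeps the set of indices, so the scan settles all triples of
the joined block. -/
theorem joinBlocks_halts {n lo mid hi : ℕ} {x y : ℕ → ℝ} {X : ℕ → ℕ} {σ : Memory}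
    (hXs : SortedOn (fun l => x (X l)) 0 n)
    (hx : σ.rarr 0 = x) (hy : σ.rarr 1 = y) (h0 : σ.narr 0 = X)
    (hY : PermBelow n (σ.narr 2)) (hB : Best n σ) (h4 : σ.nvar 4 = lo) (h5 : σ.nvar 5 = mid)
    (h6 : σ.nvar 6 = hi) (hlm : lo < mid) (hmh : mid ≤ hi) (hhn : hi ≤ n)
    (h1 : BlockDone x y X σ lo mid) (h2 : BlockDone x y X σ mid hi) :
    Halts joinBlocks σ (61100 * (hi - lo)) fun τ =>
      (PermBelow n (τ.narr 2) ∧ Best n τ) ∧ BlockDone x y X τ lo hi ∧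
        ∀ a b, b ≤ lo ∨ hi ≤ a → BlockDone x y X σ a b → BlockDone x y X τ a b := by
  subst hx hy
  refine Halts.seq (merge_halts (by norm_num) h4 h5 h6 hlm hmh h1.sorted h2.sorted)
    (B₂ := 61000 * (hi - lo)) ?_ (by omega)
  rintro ρ hF ⟨k1, k2, k3⟩
  obtain ⟨hP, him⟩ := hY.rearrange hhn k2 k3
  have hunion : ∀ f : ℕ → ℕ, f '' Set.Ico lo hi = f '' Set.Ico lo mid ∪ f '' Set.Ico mid hi :=
    fun f => by rw [← Set.image_union, Set.Ico_union_Ico_eq_Ico hlm.le hmh]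
  have him' : ρ.narr 2 '' Set.Ico lo hi = X '' Set.Ico lo hi := by
    rw [him, hunion, hunion, h1.image, h2.image]
  have rR : ρ.rarr = σ.rarr := funext fun a =>
    hF.rarr a (by simp [merge, mergeBody, copyLoop, Program.rarrs])
  have rX : ρ.narr 0 = X := (hF.narr 0 (by decide)).trans h0
  have rD : ρ.rvar 0 = σ.rvar 0 := hF.rvar 0 (by decide)
  have rB : Best n ρ := hB.congr (fun i h h' => hF.nvar i (by
    simp [merge, mergeBody, copyLoop, Program.nvars]; omega)) rD rR
  refine (strip_halts (n := n) (lo := lo) (mid := mid) (hi := hi) (x := σ.rarr 0) (y := σ.rarr 1)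
    (X := X) (Y := ρ.narr 2) (L := X '' Set.Ico lo mid) (R := X '' Set.Ico mid hi)
    ((hF.nvar 4 (by decide)).trans h4) ((hF.nvar 5 (by decide)).trans h5)
    ((hF.nvar 6 (by decide)).trans h6) (by omega) (by rw [rR]) (by rw [rR]) rX rfl
    (fun l _ h => hP.lt l (by omega)) k1 (hP.inj.mono fun l hl => hl.2.trans_le hhn)
    (by rw [him', hunion]) ?_ rB).mono le_rfl ?_
  · rw [rD]
    refine ⟨?_, ?_, h1.triples, h2.triples⟩
    · rintro _ ⟨l, hl, rfl⟩
      exact hXs l (mid - 1) (by omega) (by have := hl.2; omega) (by omega)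
    · rintro _ ⟨l, hl, rfl⟩
      exact hXs (mid - 1) l (by omega) (by have := hl.1; omega) (by have := hl.2; omega)
  · rintro τ hF' ⟨t1, t2, t3⟩
    have tY : τ.narr 2 = ρ.narr 2 := hF'.narr 2 (by decide)
    rw [him'] at t3
    refine ⟨⟨tY ▸ hP, t2⟩, ⟨tY ▸ k1, tY ▸ him', t3⟩, fun a b hab hs =>
      hs.congr (fun l h h' => ?_) (t1.trans rD.le)⟩
    rw [tY, k3 l (by omega)]

theorem sortY_halts {n : ℕ} (hn : 0 < n) {σ₀ : Memory} (h0 : σ₀.nvar 0 = n)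
    (hX : PermBelow n (σ₀.narr 0))
    (hXs : SortedOn (fun l => σ₀.rarr 0 (σ₀.narr 0 l)) 0 n)
    (hY : ∀ l < n, σ₀.narr 2 l = σ₀.narr 0 l) (hB : Best n σ₀) :
    Halts (bottomUp joinBlocks) σ₀ ((61130 * n + 20) * Nat.clog 2 n + 6) fun τ =>
      τ.rarr = σ₀.rarr ∧ Best n τ ∧
        TriplesGE (σ₀.rarr 0) (σ₀.rarr 1) (τ.rvar 0) (Set.Iio n) := by
  have hYP : PermBelow n (σ₀.narr 2) := ⟨fun l hl => hY l hl ▸ hX.lt l hl,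
    hX.inj.congr fun l hl => (hY l hl).symm⟩
  refine (bottomUp_halts (n := n) (K := 61100)
    (I := fun σ => σ.rarr = σ₀.rarr ∧ σ.narr 0 = σ₀.narr 0 ∧ PermBelow n (σ.narr 2) ∧ Best n σ)
    (seg := BlockDone (σ₀.rarr 0) (σ₀.rarr 1) (σ₀.narr 0))
    (by decide) ?_ (fun σ i m a b _ _ h => ⟨h.1, h.2, h.3⟩) ?_ ?_ hn h0 ⟨rfl, rfl, hYP, hB⟩
    ?_).mono le_rfl ?_
  · rintro σ i m h h' ⟨h1, h2, h3, h4⟩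
    refine ⟨h1, h2, h3, h4.congr (fun j _ _ => ?_) rfl rfl⟩
    rw [Memory.setN_nvar, if_neg (by omega)]
  · exact fun σ a => ⟨fun b c h1 h2 h3 => by omega, by simp, fun i hi => by simp at hi⟩
  · rintro σ lo mid hi ⟨hR, h0, hP, hB⟩ - h4 h5 h6 hlm hmh hhn h1 h2
    refine (joinBlocks_halts hXs (by rw [hR]) (by rw [hR]) h0 hP hB h4 h5 h6 hlm hmh hhn h1
      h2).mono le_rfl ?_
    rintro τ hF ⟨⟨t1, t2⟩, t3, t4⟩
    refine ⟨⟨?_, (hF.narr 0 (by decide)).trans h0, t1, t2⟩, t3, t4⟩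
    rw [← hR]
    exact funext fun a => hF.rarr a (by
      simp [joinBlocks, merge, mergeBody, copyLoop, strip, Program.rarrs, stripBody, pushStrip,
        pairLoopA, pairLoopB, tryTriple, score, addAbs, record])
  · intro a ha
    refine ⟨sortedOn_self_succ _ a, Set.image_congr fun l hl => hY l (by have := hl.2; omega), ?_⟩
    -- A block of width one has no triples.
    rintro _ ⟨l, hl, rfl⟩ _ ⟨l', hl', rfl⟩ _ _ hne
    refine absurd ?_ hne
    rw [Set.mem_Ico] at hl hl'
    rw [show l = l' by omega]
  · rintro τ - ⟨⟨h1, -, -, h2⟩, -, h3⟩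
    exact ⟨h1, h2, hX.image_Ico ▸ h3.triples⟩

/-- Makes the triple of the first three points the best one so far. -/
def initBest : Program :=
  .seq (.setN 18 (.const 0)) (.seq (.setN 19 (.const 1)) (.seq (.setN 17 (.const 2))
    (.seq score record)))

/-- Starting from an actual triple makes an infinite initial weight unnecessary; `3 ≤ n` makes the
indices `0`, `1`, `2` valid. -/
theorem initBest_halts {n : ℕ} (hn : 3 ≤ n) (σ : Memory) : Halts initBest σ 200 (Best n) := by
  refine .exec rfl (by simp [initBest, score, record, addAbs, coordDiff, Program.time, Test.cost,
    RExp.cost, NExp.cost]) ?_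
  simp only [initBest, record, Program.exec, score_exec, NExp.val, RExp.val]
  constructor <;> simp <;> omega

/-- Moves the indices of the best triple to the output variables. -/
def output : Program :=
  .seq (.setN 0 (.var 14)) (.seq (.setN 1 (.var 15)) (.setN 2 (.var 16)))

/-- Divide and conquer for a minimum triple: sorts the points by `x`-coordinate, and then, in a
second merge sort, by `y`-coordinate, scanning a strip after each merge. -/
def minTriple : Program :=
  .seq (fill 0 (.var 9)) (.seq (bottomUp (merge 0 0)) (.seq (fill 2 (.cell 0 (.var 9)))
    (.seq initBest (.seq (bottomUp joinBlocks) output))))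

theorem minTriple_halts {n : ℕ} (hn : 3 ≤ n) {σ₀ : Memory} (h0 : σ₀.nvar 0 = n) :
    Halts minTriple σ₀ (62000 * (n * Nat.clog 2 n)) fun τ =>
      ∃ i j k, τ.nvar 0 = i ∧ τ.nvar 1 = j ∧ τ.nvar 2 = k ∧ i < n ∧ j < n ∧ k < n ∧
        i ≠ j ∧ i ≠ k ∧ j ≠ k ∧
        TriplesGE (σ₀.rarr 0) (σ₀.rarr 1) (triWeight (σ₀.rarr 0) (σ₀.rarr 1) i j k)
          (Set.Iio n) := by
  -- These three bounds absorb the lower-order terms into `n * Nat.clog 2 n`.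
  have hc : 1 ≤ Nat.clog 2 n := Nat.clog_pos (by norm_num) (by omega)
  have hnc : n ≤ n * Nat.clog 2 n := Nat.le_mul_of_pos_right n hc
  have hcn : 3 * Nat.clog 2 n ≤ n * Nat.clog 2 n := Nat.mul_le_mul_right _ hn
  have hB : (20 * n + 6) + (((130 * n + 20) * Nat.clog 2 n + 6) + ((20 * n + 6) + (200 +
      (((61130 * n + 20) * Nat.clog 2 n + 6) + 6)))) ≤ 62000 * (n * Nat.clog 2 n) := by
    rw [add_mul, add_mul, mul_assoc, mul_assoc]
    omega
  refine Halts.seq (fill_halts (g := id) h0 (by simp [NExp.cost]) fun _ _ => rfl) ?_ hB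
  intro σ₁ hF₁ hσ₁
  have e1R : σ₁.rarr = σ₀.rarr := funext fun a => hF₁.rarr a (by simp [fill, Program.rarrs])
  have hP₁ : PermBelow n (σ₁.narr 0) :=
    ⟨fun l hl => by rw [hσ₁ l hl]; exact hl, fun a ha b hb he => by
      rw [hσ₁ a ha, hσ₁ b hb] at he; exact he⟩
  refine Halts.seq (sortX_halts (by omega) ((hF₁.nvar 0 (by decide)).trans h0) hP₁) ?_ le_rfl
  rintro σ₂ - ⟨e2R, hP₂, e20, hs₂⟩
  refine Halts.seq (fill_halts (g := σ₂.narr 0) e20 (by simp [NExp.cost]) fun σ hσ => by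
    rw [NExp.val, hσ.narr 0 (by decide)]; rfl) ?_ le_rfl
  intro σ₃ hF₃ hσ₃
  have e3X : σ₃.narr 0 = σ₂.narr 0 := hF₃.narr 0 (by decide)
  have e3R : σ₃.rarr = σ₂.rarr := funext fun a => hF₃.rarr a (by simp [fill, Program.rarrs])
  refine Halts.seq (initBest_halts hn σ₃) ?_ le_rfl
  intro σ₄ hF₄ hB₄
  have e4X : σ₄.narr 0 = σ₂.narr 0 := (hF₄.narr 0 (by decide)).trans e3X
  have e4R : σ₄.rarr = σ₀.rarr := by
    rw [← e1R, ← e2R, ← e3R]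
    exact funext fun a => hF₄.rarr a (by simp [initBest, score, addAbs, record, Program.rarrs])
  refine Halts.seq (sortY_halts (by omega)
    ((hF₄.nvar 0 (by decide)).trans ((hF₃.nvar 0 (by decide)).trans e20)) (by rwa [e4X])
    (by rw [e4X, e4R, ← e1R]; exact hs₂)
    (fun l hl => by rw [hF₄.narr 2 (by decide), hσ₃ l hl, e4X]) hB₄) ?_ le_rfl
  rintro σ₅ - ⟨e5R, hB₅, hT⟩
  refine .exec rfl (by simp [output, Program.time, NExp.cost]) ?_
  rw [e4R] at e5R hT
  have hw := hB₅.weight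
  rw [e5R] at hw
  rw [hw] at hT
  exact ⟨_, _, _, by simp [output, Program.exec, NExp.val], by simp [output, Program.exec, NExp.val],
    by simp [output, Program.exec, NExp.val], hB₅.fst_lt, hB₅.snd_lt, hB₅.trd_lt, hB₅.fst_ne_snd,
    hB₅.fst_ne_trd, hB₅.snd_ne_trd, hT⟩

end RealRAM

/-! ### Medians, Steiner stars and the Voronoi cell -/

/-- For `a ≤ b ≤ c` both sides rest on `|x - a| + |x - c| ≥ c - a`, and `c - a` is half the pairwise
sum; the remaining term `|x - b|` makes the minimum at `b` sharp. -/
theorem exists_median (a b c : ℝ) : ∃ m : ℝ,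
    |m - a| + |m - b| + |m - c| = (|a - b| + |a - c| + |b - c|) / 2 ∧
    ∀ x, (|a - b| + |a - c| + |b - c|) / 2 + |x - m| ≤ |x - a| + |x - b| + |x - c| := by
  have key : ∀ a b c : ℝ, a ≤ b → b ≤ c →
      |b - a| + |b - b| + |b - c| = (|a - b| + |a - c| + |b - c|) / 2 ∧
      ∀ x, (|a - b| + |a - c| + |b - c|) / 2 + |x - b| ≤ |x - a| + |x - b| + |x - c| := by
    intro a b c hab hbc
    rw [abs_of_nonneg (sub_nonneg.2 hab), abs_of_nonpos (sub_nonpos.2 hab),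
      abs_of_nonpos (sub_nonpos.2 hbc), abs_of_nonpos (sub_nonpos.2 (hab.trans hbc)), sub_self,
      abs_zero]
    refine ⟨by ring, fun x => ?_⟩
    linarith [le_abs_self (x - a), neg_le_abs (x - c)]
  -- The two cyclic combinations force all three numbers to be equal, and `b` serves there too.
  rcases le_total a b with h1 | h1 <;> rcases le_total b c with h2 | h2 <;>
    rcases le_total a c with h3 | h3
  · exact ⟨b, key a b c h1 h2⟩
  · exact ⟨b, key a b c h1 h2⟩
  · refine ⟨c, ?_⟩
    have h := key a c b h3 h2
    rw [abs_sub_comm b c]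
    exact ⟨by linarith [h.1], fun x => by linarith [h.2 x]⟩
  · refine ⟨a, ?_⟩
    have h := key c a b h3 h1
    rw [abs_sub_comm b c, abs_sub_comm a c]
    exact ⟨by linarith [h.1, abs_sub_comm a c], fun x => by linarith [h.2 x]⟩
  · refine ⟨a, ?_⟩
    have h := key b a c h1 h3
    rw [abs_sub_comm a b]
    exact ⟨by linarith [h.1, abs_sub_comm a b], fun x => by linarith [h.2 x]⟩
  · refine ⟨c, ?_⟩
    have h := key b c a h2 h3
    rw [abs_sub_comm a b, abs_sub_comm a c]
    exact ⟨by linarith [h.1], fun x => by linarith [h.2 x]⟩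
  · refine ⟨b, ?_⟩
    have h := key c b a h2 h1
    rw [abs_sub_comm b c, abs_sub_comm a c, abs_sub_comm a b]
    exact ⟨by linarith [h.1, abs_sub_comm a b, abs_sub_comm b c],
      fun x => by linarith [h.2 x]⟩
  · refine ⟨b, ?_⟩
    have h := key c b a h2 h1
    rw [abs_sub_comm b c, abs_sub_comm a c, abs_sub_comm a b]
    exact ⟨by linarith [h.1, abs_sub_comm a b, abs_sub_comm b c],
      fun x => by linarith [h.2 x]⟩

theorem totalPairwiseDist_triple {a b c : ℝ × ℝ} (hab : a ≠ b) (hac : a ≠ c) (hbc : b ≠ c) :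
    totalPairwiseDist {a, b, c} = l1Dist a b + l1Dist a c + l1Dist b c := by
  have hself : ∀ a, l1Dist a a = 0 := fun a => by simp [l1Dist]
  have hcomm : ∀ a b, l1Dist a b = l1Dist b a := fun a b => by
    rw [l1Dist, l1Dist, abs_sub_comm, abs_sub_comm a.2]
  have hsum : ∀ f : ℝ × ℝ → ℝ, ∑ s ∈ ({a, b, c} : Finset (ℝ × ℝ)), f s = f a + f b + f c :=
    fun f => by
      rw [Finset.sum_insert (by simp [hab, hac]), Finset.sum_pair hbc, add_assoc]
  simp only [totalPairwiseDist, hsum, hself, hcomm b a, hcomm c a, hcomm c b]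
  ring

/-- The optimal Steiner star of a triple is half its total pairwise distance long, and its
centre is a sharp minimum. -/
theorem exists_centre {S : Finset (ℝ × ℝ)} (hS : S.card = 3) : ∃ c : ℝ × ℝ,
    starLength S c = totalPairwiseDist S / 2 ∧
    ∀ x, totalPairwiseDist S / 2 + l1Dist x c ≤ starLength S x := by
  obtain ⟨a, b, c, hab, hac, hbc, rfl⟩ := Finset.card_eq_three.1 hS
  -- The `L₁` star length splits into coordinates, so the centre is the pair of the two medians.
  obtain ⟨m, hm, hm'⟩ := exists_median a.1 b.1 c.1
  obtain ⟨m₂, hm₂, hm₂'⟩ := exists_median a.2 b.2 c.2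
  have hstar : ∀ x, starLength {a, b, c} x = l1Dist x a + l1Dist x b + l1Dist x c := fun x => by
    rw [starLength, Finset.sum_insert (by simp [hab, hac]), Finset.sum_pair hbc, add_assoc]
  refine ⟨(m, m₂), ?_, fun x => ?_⟩
  · rw [hstar, totalPairwiseDist_triple hab hac hbc]
    simp only [l1Dist]
    linarith
  · rw [hstar, totalPairwiseDist_triple hab hac hbc]
    simp only [l1Dist]
    linarith [hm' x.1, hm₂' x.2]

/-- Shortest stars are half the total distance, so minimality of `S` passes to stars; the sharp term
`l1Dist x c` gives uniqueness of the centre. -/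
theorem IsMinTriple.exists_centre {P S : Finset (ℝ × ℝ)} (h : IsMinTriple P S) :
    ∃ c : ℝ × ℝ, (∀ x : ℝ × ℝ, IsStarCentre S x ↔ x = c) ∧
      (∀ T : Finset (ℝ × ℝ), T ⊆ P → T.card = 3 →
        ∀ x : ℝ × ℝ, starLength S c ≤ starLength T x) ∧
      c ∈ voronoiCell P S := by
  classical
  obtain ⟨hSP, hS, hmin⟩ := h
  obtain ⟨c, hc, hc'⟩ := _root_.exists_centre hS
  have nonneg : ∀ a b, 0 ≤ l1Dist a b := fun a b => by unfold l1Dist; positivity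
  have hopt : ∀ T : Finset (ℝ × ℝ), T ⊆ P → T.card = 3 →
      ∀ x : ℝ × ℝ, starLength S c ≤ starLength T x := by
    intro T hTP hT x
    obtain ⟨d, -, hd⟩ := _root_.exists_centre hT
    linarith [hmin T hTP hT, hd x, nonneg x d]
  refine ⟨c, fun x => ⟨fun hx => ?_, ?_⟩, hopt, fun s hs q hq hqS => ?_⟩
  · have h0 : |x.1 - c.1| + |x.2 - c.2| ≤ 0 := by
      have h1 := hc' x
      have h2 := hx c
      rw [l1Dist] at h1
      linarith
    have h1 := abs_nonneg (x.1 - c.1)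
    have h2 := abs_nonneg (x.2 - c.2)
    exact Prod.ext (sub_eq_zero.1 (abs_eq_zero.1 (by linarith)))
      (sub_eq_zero.1 (abs_eq_zero.1 (by linarith)))
  · rintro rfl
    exact hopt S hSP hS
  -- Exchange `s` for `q`: the new star at the same centre is no shorter, and the two common terms
  -- cancel.
  · have hq' : q ∉ S.erase s := fun h => hqS (Finset.mem_of_mem_erase h)
    have := hopt (insert q (S.erase s))
      (Finset.insert_subset hq ((Finset.erase_subset _ _).trans hSP))
      (by rw [Finset.card_insert_of_notMem hq', Finset.card_erase_of_mem hs, hS]) c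
    rw [starLength, starLength, Finset.sum_insert hq', ← Finset.add_sum_erase S _ hs] at this
    linarith

/-! ### From steps and indices to the theorem -/

/-- `Nat.clog` exceeds `Nat.log` by at most one; `log 2 > 1 / 2` bounds the binary logarithm by `2 *
log n`, and `log n ≥ 1`, from `exp 1 < 3 ≤ n`, pays for the extra one. -/
theorem clog_two_le_three_mul_log {n : ℕ} (hn : 3 ≤ n) : (Nat.clog 2 n : ℝ) ≤ 3 * Real.log n := by
  have hn' : (3 : ℝ) ≤ n := by exact_mod_cast hn
  have h1 : (1 : ℝ) ≤ Real.log n := by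
    rw [Real.le_log_iff_exp_le (by linarith)]
    linarith [Real.exp_one_lt_d9]
  have h2 : (Nat.clog 2 n : ℝ) ≤ Nat.log 2 n + 1 := by
    exact_mod_cast Nat.clog_le_of_le_pow (Nat.lt_pow_succ_log_self (by norm_num) n).le
  have h3 : (Nat.log 2 n : ℝ) ≤ Real.log n / Real.log 2 := by
    simpa [Real.logb] using Real.natLog_le_logb n 2
  have h4 : Real.log n / Real.log 2 ≤ 2 * Real.log n := by
    rw [div_le_iff₀ (Real.log_pos (by norm_num))]
    nlinarith [Real.log_two_gt_d9]
  linarith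

theorem isMinTriple_of_triplesGE {n : ℕ} {p : Fin n → ℝ × ℝ} (hp : Function.Injective p)
    {x y : ℕ → ℝ} (hx : ∀ i : Fin n, x i = (p i).1) (hy : ∀ i : Fin n, y i = (p i).2)
    {i j k : Fin n} (hij : i ≠ j) (hik : i ≠ k) (hjk : j ≠ k)
    (h : TriplesGE x y (triWeight x y i j k) (Set.Iio n)) :
    IsMinTriple (pointSet p) {p i, p j, p k} := by
  have hw : ∀ i j k : Fin n, i ≠ j → i ≠ k → j ≠ k →
      totalPairwiseDist {p i, p j, p k} = triWeight x y i j k := fun i j k hij hik hjk => by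
    rw [totalPairwiseDist_triple (hp.ne hij) (hp.ne hik) (hp.ne hjk)]
    simp only [triWeight, l1Dist, hx, hy]
  refine ⟨?_, Finset.card_eq_three.2 ⟨_, _, _, hp.ne hij, hp.ne hik, hp.ne hjk, rfl⟩, ?_⟩
  · intro q hq
    simp only [Finset.mem_insert, Finset.mem_singleton] at hq
    rcases hq with rfl | rfl | rfl <;> simp [pointSet]
  · intro T hT hT3
    obtain ⟨a, b, c, hab, hac, hbc, rfl⟩ := Finset.card_eq_three.1 hT3
    have mem : ∀ q ∈ ({a, b, c} : Finset (ℝ × ℝ)), ∃ l, p l = q := fun q hq => by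
      simpa [pointSet] using hT hq
    obtain ⟨i', rfl⟩ := mem a (by simp)
    obtain ⟨j', rfl⟩ := mem b (by simp)
    obtain ⟨k', rfl⟩ := mem c (by simp)
    have hij' : i' ≠ j' := fun h => hab (h ▸ rfl)
    have hik' : i' ≠ k' := fun h => hac (h ▸ rfl)
    have hjk' : j' ≠ k' := fun h => hbc (h ▸ rfl)
    rw [hw _ _ _ hij hik hjk, hw _ _ _ hij' hik' hjk']
    exact h _ i'.2 _ j'.2 _ k'.2 (Fin.val_ne_of_ne hij') (Fin.val_ne_of_ne hik')
      (Fin.val_ne_of_ne hjk')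

theorem mainTheorem6 :
    -- one program finds a minimum triple of every set of `n ≥ 3` points in `O(n log n)` steps;
    -- it returns the indices of the three points in natural variables `0`, `1`, `2`
    (∃ (prog : RealRAM.Program) (C : ℝ), ∀ (n : ℕ), 3 ≤ n →
      ∀ p : Fin n → ℝ × ℝ, Function.Injective p →
        ∃ (t : ℕ) (τ : RealRAM.Memory),
          RealRAM.Runs prog (RealRAM.inputMemory p) t τ ∧
          (t : ℝ) ≤ C * (n * Real.log n) ∧
          ∃ i j k : Fin n,
            τ.nvar 0 = i ∧ τ.nvar 1 = j ∧ τ.nvar 2 = k ∧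
            IsMinTriple (pointSet p) {p i, p j, p k}) ∧
    -- a minimum triple consists of the three nearest points to the centre of its smallest
    -- Steiner star, which is smallest among the Steiner stars of all triples
    (∀ P S : Finset (ℝ × ℝ), IsMinTriple P S →
      ∃ c : ℝ × ℝ,
        (∀ x : ℝ × ℝ, IsStarCentre S x ↔ x = c) ∧
        (∀ T : Finset (ℝ × ℝ), T ⊆ P → T.card = 3 →
          ∀ x : ℝ × ℝ, starLength S c ≤ starLength T x) ∧
        c ∈ voronoiCell P S) := by
  -- The constant is `3 * 62000`: the step bound times the passage from `Nat.clog 2 n` to `Real.log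
  -- n`.
  refine ⟨⟨RealRAM.minTriple, 186000, fun n hn p hp => ?_⟩, fun P S h => h.exists_centre⟩
  obtain ⟨t, τ, hr, ht, i, j, k, h0, h1, h2, hi, hj, hk, hij, hik, hjk, hT⟩ :=
    RealRAM.minTriple_halts hn (σ₀ := RealRAM.inputMemory p) (by simp [RealRAM.inputMemory])
  refine ⟨t, τ, hr, ?_, ⟨i, hi⟩, ⟨j, hj⟩, ⟨k, hk⟩, h0, h1, h2, ?_⟩
  · have ht' : (t : ℝ) ≤ 62000 * (n * Nat.clog 2 n) := by exact_mod_cast ht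
    have := mul_le_mul_of_nonneg_left (clog_two_le_three_mul_log hn) (Nat.cast_nonneg (α := ℝ) n)
    linarith
  · refine isMinTriple_of_triplesGE hp (fun i => ?_) (fun i => ?_) (by simpa using hij)
      (by simpa using hik) (by simpa using hjk) hT <;>
    simp [RealRAM.inputMemory]
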